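/- **Setting.** Let $X$ be a Polish space with a $\sigma$-finite Borel measure $m$ of full support, and let $\mathcal E:L^2(m)\to[0,\infty]$ be a symmetric, densely defined, strongly local Dirichlet form with domain $\mathbb V=\{\mathcal E<\infty\}$, $\|f\|_{\mathbb V}^2=\|f\|_2^2+\mathcal E(f)$; that is, $\mathcal E$ is a lower semicontinuous quadratic form, $\mathcal E(\theta\circ f)\le\mathcal E(f)$ for every $1$-Lipschitz $\theta:\mathbb R\to\mathbb R$ with $\theta(0)=0$, and (for the associated bilinear form) $\mathcal E(f,g)=0$ whenever $f,g\in\mathbb V$ and $(f+a)g=0$ a.e. for some $a\in\mathbb R$. Assume that it has a carré du champ: for each $f\in\mathbb V$ there is $\Gamma(f)\in L^1(m)$, $\Gamma(f)\ge0$, which is the density of the linear form $\varphi\mapsto\mathcal E(f,f\varphi)-\tfrac12\mathcal E(f^2,\varphi)$, $\varphi\in\mathbb V\cap L^\infty$ (defined for $f\in\mathbb V\cap L^\infty$ and extended by continuity to $f\in\mathbb V$). Let $\mathscr A\subset\mathbb V\cap\bigcap_{p\in[1,\infty]}L^p(m)$ be a linear subspace dense in $\mathbb V$, with $\Gamma(f)\in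 L^\infty(m)$ for all $f\in\mathscr A$, and such that $\Phi(f_1,\dots,f_n)\in\mathscr A$ whenever $f_i\in\mathscr A$, $\Phi\in C^1(\mathbb R^n)$ and $\Phi(0)=0$. A *derivation* $b$ is a linear map $f\mapsto df(b)$ from $\mathscr A$ to the space $L^0(m)$ of classes of a.e. finite Borel functions, with $d(fg)(b)=f\,dg(b)+g\,df(b)$ and $|df(b)|\le g\sqrt{\Gamma(f)}$ a.e. for all $f\in\mathscr A$, for some $g\in L^0(m)$; the smallest such $g$ is $|b|$. Let $T\in(0,\infty)$ and let $(b_t)_{t\in(0,T)}$ be a Borel family of derivations (i.e. there is a Borel $g:(0,T)\times X\to[0,\infty)$ with $|b_t|\le g(t,\cdot)$ $m$-a.e. for a.e. $t$; the smallest such $g$ is denoted $|b|$). Fix Borel representatives of all $f\in\mathscr A$ and of all maps $(t,x)\mapsto df(b_t)(x)$, $f\in\mathscr A$. Let $\mathcal L_+$ be the class of all $u\in L^\infty_t(L^1_x\cap L^\infty_x)$, $u\ge0$, such that $t\mapsto u_t$ is weakly continuous on $[0,T]$ in duality with $\mathscr A$. Such a $u$ solves the continuity equation $\partial_tu_t+\operatorname{div}(u_tb_t)=0$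 with initial datum $\bar u$ if $$\int_0^T\!\!\int\bigl[-\psi'\varphi-\psi\,d\varphi(b_t)\bigr]u_t\,dm\,dt=\psi(0)\int\varphi\,\bar u\,dm\qquad\text{for all }\varphi\in\mathscr A,\ \psi\in C^1([0,T])\text{ with }\psi(T)=0.$$ Write $e_t:C([0,T];X)\to X$, $e_t(\gamma)=\gamma(t)$. A curve $\gamma\in C([0,T];X)$ solves the ODE $\dot\gamma=b_t(\gamma)$ tested on $f\in\mathscr A$ if $f\circ\gamma\in W^{1,1}(0,T)$ and $(f\circ\gamma)'(t)=df(b_t)(\gamma(t))$ for a.e. $t\in(0,T)$. A Borel probability measure $\eta$ on $C([0,T];X)$ is concentrated on solutions to the ODE if, for every $f\in\mathscr A$, $\eta$-a.e. $\gamma$ solves the ODE tested on $f$. **Theorem 8.4 (No splitting criterion).** Assume that $|b|\in L^1_t(L^1_x+L^\infty_x)$ and that, for every $\bar u\in L^1\cap L^\infty(m)$, the continuity equation with initial datum $\bar u$ has at most one solution in $\mathcal L_+$. Let $\eta$ be a Borel probability measure on $C([0,T];X)$ such that 1. $\eta$ is concentrated on solutions to the ODE $\dot\gamma=b_t(\gamma)$;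 2. there is $L_0\in[0,\infty)$ with $(e_t)_\#\eta\le L_0\,m$ for all $t\in[0,T]$. Then the conditional probability measures $\eta_x$ of $\eta$ induced by the map $e_0$ are Dirac masses for $(e_0)_\#\eta$-a.e. $x$. Equivalently, there is a Borel map $X\ni x\mapsto\gamma_x\in C([0,T];X)$ with $\gamma_x(0)=x$ for all $x$, such that for every $f\in\mathscr A$ the curve $\gamma_x$ solves the ODE tested on $f$ for $(e_0)_\#\eta$-a.e. $x$, and $$\eta=\int\delta_{\gamma_x}\,d(e_0)_\#\eta(x).$$ Both assertions hold. -/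

import Mathlib

open MeasureTheory ProbabilityTheory Set Filter Topology
open scoped ENNReal NNReal

noncomputable section

namespace NoSplitting

variable {X : Type*} [MeasurableSpace X]

/-! ### Symmetric strongly local Dirichlet forms with a carré du champ -/

/-- The product of two classes of functions, as an element of `L²` (and `0` if the product is not
square integrable). -/
def prodL2 {m : Measure X} (f g : Lp ℝ 2 m) : Lp ℝ 2 m :=
  open Classical in
  if h : MemLp (fun x => f x * g x) 2 m then h.toLp _ else 0

/-- The symmetric bilinear form obtained by polarisation from `E : L² → [0, ∞]`; it is meaningful
on the domain `{E < ∞}`. -/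
def polar {m : Measure X} (E : Lp ℝ 2 m → ℝ≥0∞) (f g : Lp ℝ 2 m) : ℝ :=
  ((E (f + g)).toReal - (E (f - g)).toReal) / 4

/-- A symmetric, densely defined, strongly local Dirichlet form on `L²(m)`: a lower semicontinuous
quadratic form with values in `[0, ∞]`, with dense domain, not increased by normal contractions,
and such that `E (f, g) = 0` whenever `(f + a) g = 0` a.e. for some constant `a`. -/
structure DirichletForm (m : Measure X) where
  /-- the quadratic form -/
  E : Lp ℝ 2 m → ℝ≥0∞
  smul : ∀ (c : ℝ) (f : Lp ℝ 2 m), E (c • f) = ENNReal.ofReal (c ^ 2) * E f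
  parallelogram : ∀ f g : Lp ℝ 2 m, E (f + g) + E (f - g) = 2 * E f + 2 * E g
  lsc : LowerSemicontinuous E
  dense : Dense {f : Lp ℝ 2 m | E f < ∞}
  markov : ∀ (θ : ℝ → ℝ) (hθ : LipschitzWith 1 θ) (h0 : θ 0 = 0) (f : Lp ℝ 2 m),
    E (hθ.compLp h0 f) ≤ E f
  stronglyLocal : ∀ f g : Lp ℝ 2 m, E f < ∞ → E g < ∞ →
    (∃ a : ℝ, ∀ᵐ x ∂m, (f x + a) * g x = 0) → polar E f g = 0

namespace DirichletForm

variable {m : Measure X}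

/-- The domain `𝕍` of the form. -/
def dom (𝓔 : DirichletForm m) : Set (Lp ℝ 2 m) := {f | 𝓔.E f < ∞}

/-- The bounded elements of the domain. -/
def bddDom (𝓔 : DirichletForm m) : Set (Lp ℝ 2 m) := {f | 𝓔.E f < ∞ ∧ MemLp f ∞ m}

/-- The square of the norm of `𝕍`. -/
def normSq (𝓔 : DirichletForm m) (f : Lp ℝ 2 m) : ℝ≥0∞ :=
  ENNReal.ofReal (‖f‖ ^ 2) + 𝓔.E f

/-- `Γ[f; φ] = E (f, f φ) - E (f², φ) / 2`, for bounded `f`, `φ` in the domain. -/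
def gammaForm (𝓔 : DirichletForm m) (f φ : Lp ℝ 2 m) : ℝ :=
  polar 𝓔.E f (prodL2 f φ) - polar 𝓔.E (prodL2 f f) φ / 2

end DirichletForm

/-- A carré du champ of a Dirichlet form: for every `f` in the domain, `Γ f ∈ L¹` is nonnegative
and is the density of the linear form `φ ↦ Γ[f; φ]`, the latter being extended by continuity from
the bounded elements of the domain to the whole domain. The values of `Γ` outside the domain are
irrelevant. -/
structure CarreDuChamp {m : Measure X} (𝓔 : DirichletForm m) where
  /-- the carré du champ `f ↦ Γ(f)` -/
  Γ : Lp ℝ 2 m → Lp ℝ 1 m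
  nonneg : ∀ f ∈ 𝓔.dom, 0 ≤ᵐ[m] Γ f
  represents : ∀ f ∈ 𝓔.dom, ∀ F : ℕ → Lp ℝ 2 m, (∀ n, F n ∈ 𝓔.bddDom) →
    Tendsto (fun n => 𝓔.normSq (F n - f)) atTop (𝓝 0) →
    ∀ φ ∈ 𝓔.bddDom,
      Tendsto (fun n => 𝓔.gammaForm (F n) φ) atTop (𝓝 (∫ x, φ x * Γ f x ∂m))

/-! ### The algebra of test functions -/

/-- The standing assumptions on the algebra `A` of test functions: it is a subspace of the domain,
dense in it, contained in every `Lᵖ`, `p ∈ [1, ∞]`, closed under composition with `C¹` functions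
of several variables vanishing at the origin (in particular under products), and `Γ(f)` is
essentially bounded for every `f ∈ A`. -/
structure IsTestAlgebra {m : Measure X} {𝓔 : DirichletForm m} (C : CarreDuChamp 𝓔)
    (A : Submodule ℝ (Lp ℝ 2 m)) : Prop where
  subset_dom : ∀ f ∈ A, f ∈ 𝓔.dom
  memLp : ∀ f ∈ A, ∀ p : ℝ≥0∞, 1 ≤ p → MemLp f p m
  dense : ∀ f ∈ 𝓔.dom, ∀ ε : ℝ≥0∞, 0 < ε → ∃ g ∈ A, 𝓔.normSq (g - f) < ε
  comp : ∀ (n : ℕ) (Φ : (Fin n → ℝ) → ℝ), ContDiff ℝ 1 Φ → Φ 0 = 0 →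
    ∀ f : Fin n → Lp ℝ 2 m, (∀ i, f i ∈ A) →
      ∃ h ∈ A, h =ᵐ[m] fun x => Φ (fun i => f i x)
  gamma_bdd : ∀ f ∈ A, MemLp (C.Γ f) ∞ m

/-! ### Derivations -/

/-- A derivation: a linear map `f ↦ df(b)` from `A` to `L⁰(m)` satisfying the Leibniz rule and a
pointwise bound `|df(b)| ≤ g √Γ(f)` for some `g ∈ L⁰(m)`. -/
structure Deriv {m : Measure X} {𝓔 : DirichletForm m} (C : CarreDuChamp 𝓔)
    (A : Submodule ℝ (Lp ℝ 2 m)) where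
  /-- the action `f ↦ df(b)` -/
  d : A →ₗ[ℝ] (X →ₘ[m] ℝ)
  leibniz : ∀ f g h : A, ((h : Lp ℝ 2 m) =ᵐ[m] fun x => (f : Lp ℝ 2 m) x * (g : Lp ℝ 2 m) x) →
    d h =ᵐ[m] fun x => (f : Lp ℝ 2 m) x * d g x + (g : Lp ℝ 2 m) x * d f x
  bound : ∃ g : X →ₘ[m] ℝ, ∀ f : A, ∀ᵐ x ∂m, |d f x| ≤ g x * √(C.Γ (f : Lp ℝ 2 m) x)

section Families

variable {m : Measure X} {𝓔 : DirichletForm m} {C : CarreDuChamp 𝓔}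
  {A : Submodule ℝ (Lp ℝ 2 m)}

/-- `g : (0,T) × X → [0,∞)` is Borel and `|b_t| ≤ g (t, ·)` a.e. in `X`, for a.e. `t ∈ (0, T)`.
Only the values `b t` with `t ∈ (0, T)` matter. -/
def Dominates (T : ℝ) (b : ℝ → Deriv C A) (g : ℝ × X → ℝ) : Prop :=
  Measurable g ∧ (∀ z, 0 ≤ g z) ∧
    ∀ᵐ t ∂(volume.restrict (Ioo 0 T)), ∀ f : A, ∀ᵐ x ∂m,
      |(b t).d f x| ≤ g (t, x) * √(C.Γ (f : Lp ℝ 2 m) x)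

/-- `g` is (a representative of) `|b|`: the smallest function, up to a.e. equality in
`(0, T) × X`, dominating the family `b`. -/
def IsModulus (T : ℝ) (b : ℝ → Deriv C A) (g : ℝ × X → ℝ) : Prop :=
  Dominates T b g ∧
    ∀ g', Dominates T b g' → ∀ᵐ z ∂((volume.restrict (Ioo 0 T)).prod m), g z ≤ g' z

/-- The space `L¹_t(L¹_x + L^∞_x)` on `(0, T) × X`. -/
def MemL1L1Linf (T : ℝ) (m : Measure X) (g : ℝ × X → ℝ) : Prop :=
  ∃ g₁ g₂ : ℝ × X → ℝ, Measurable g₁ ∧ Measurable g₂ ∧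
    (∀ᵐ t ∂(volume.restrict (Ioo 0 T)), ∀ᵐ x ∂m, g (t, x) = g₁ (t, x) + g₂ (t, x)) ∧
    ∫⁻ t in Ioo 0 T, eLpNorm (fun x => g₁ (t, x)) 1 m < ∞ ∧
    ∫⁻ t in Ioo 0 T, eLpNorm (fun x => g₂ (t, x)) ∞ m < ∞

/-- `b = (b_t)` is a Borel family of derivations with `|b| ∈ L¹_t(L¹_x + L^∞_x)`. -/
def FamilyInL1L1Linf (T : ℝ) (b : ℝ → Deriv C A) : Prop :=
  ∃ g : ℝ × X → ℝ, IsModulus T b g ∧ MemL1L1Linf T m g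

/-- A choice of Borel representatives of the functions `f ∈ A` and of the maps
`(t, x) ↦ df(b_t)(x)`, `f ∈ A`. -/
structure BorelRep (T : ℝ) (b : ℝ → Deriv C A) where
  /-- representative of `f` -/
  fn : A → X → ℝ
  /-- representative of `(t, x) ↦ df(b_t)(x)` -/
  dfn : A → ℝ × X → ℝ
  measurable_fn : ∀ f, Measurable (fn f)
  fn_ae : ∀ f : A, fn f =ᵐ[m] (f : Lp ℝ 2 m)
  measurable_dfn : ∀ f, Measurable (dfn f)
  dfn_ae : ∀ f : A, ∀ᵐ t ∂(volume.restrict (Ioo 0 T)),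
    (fun x => dfn f (t, x)) =ᵐ[m] (b t).d f

/-! ### The continuity equation -/

/-- `u` solves `∂ₜ u + div (u b) = 0` in `(0, T) × X` with initial condition `u₀`, weakly. -/
def SolvesContinuityEq (T : ℝ) (b : ℝ → Deriv C A) (u : ℝ → X → ℝ) (u₀ : X → ℝ) : Prop :=
  ∀ (φ : A) (ψ : ℝ → ℝ), ContDiff ℝ 1 ψ → ψ T = 0 →
    ∫ t in Ioo 0 T, ∫ x, (-(deriv ψ t) * (φ : Lp ℝ 2 m) x - ψ t * (b t).d φ x) * u t x ∂m
      = ψ 0 * ∫ x, (φ : Lp ℝ 2 m) x * u₀ x ∂m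

variable (m A) in
/-- The class `𝓛₊`: functions `u ≥ 0` in `L^∞_t(L¹_x ∩ L^∞_x)` such that `t ↦ u_t` is weakly
continuous in `[0, T]`, in duality with `A`. -/
structure MemLPlus (T : ℝ) (u : ℝ → X → ℝ) : Prop where
  aesm : AEStronglyMeasurable (Function.uncurry u) ((volume.restrict (Ioo 0 T)).prod m)
  memLp_one : ∀ t ∈ Icc 0 T, MemLp (u t) 1 m
  memLp_top : ∀ t ∈ Icc 0 T, MemLp (u t) ∞ m
  bdd : ∃ K : ℝ≥0, ∀ᵐ t ∂(volume.restrict (Ioo 0 T)),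
    eLpNorm (u t) 1 m ≤ K ∧ eLpNorm (u t) ∞ m ≤ K
  nonneg : ∀ t ∈ Icc 0 T, 0 ≤ᵐ[m] u t
  weakCont : ∀ f ∈ A, ContinuousOn (fun t => ∫ x, f x * u t x ∂m) (Icc 0 T)

/-- For every initial datum in `L¹ ∩ L^∞`, the continuity equation has at most one solution in the
class `𝓛₊`. -/
def UniqueInLPlus (T : ℝ) (b : ℝ → Deriv C A) : Prop :=
  ∀ u₀ : X → ℝ, MemLp u₀ 1 m → MemLp u₀ ∞ m →
    ∀ u v : ℝ → X → ℝ, MemLPlus m A T u → MemLPlus m A T v →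
      SolvesContinuityEq T b u u₀ → SolvesContinuityEq T b v u₀ →
        ∀ t ∈ Icc 0 T, u t =ᵐ[m] v t

/-! ### Curves and the ODE -/

/-- `h ∈ W^{1,1}(0, T)` with weak derivative `k`. -/
def HasW11Deriv (T : ℝ) (h k : ℝ → ℝ) : Prop :=
  IntegrableOn h (Ioo 0 T) ∧ IntegrableOn k (Ioo 0 T) ∧
    ∀ ψ : ℝ → ℝ, ContDiff ℝ 1 ψ → HasCompactSupport ψ → tsupport ψ ⊆ Ioo 0 T →
      ∫ t in Ioo 0 T, deriv ψ t * h t = -∫ t in Ioo 0 T, ψ t * k t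

/-- The curve `γ` satisfies the ODE `γ' = b_t(γ)` tested against `f`: `f ∘ γ ∈ W^{1,1}(0, T)` and
`(f ∘ γ)'(t) = df(b_t)(γ(t))` for a.e. `t`. -/
def SolvesODE [TopologicalSpace X] {T : ℝ} (hT : 0 < T) {b : ℝ → Deriv C A} (R : BorelRep T b)
    (f : A) (γ : C(Icc (0 : ℝ) T, X)) : Prop :=
  HasW11Deriv T (fun t => R.fn f (IccExtend hT.le γ t))
    (fun t => R.dfn f (t, IccExtend hT.le γ t))

/-- `η` is concentrated on solutions to the ODE `γ' = b_t(γ)`. -/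
def ConcentratedOnSolutions [TopologicalSpace X] {T : ℝ} (hT : 0 < T) {b : ℝ → Deriv C A}
    (R : BorelRep T b) [MeasurableSpace C(Icc (0 : ℝ) T, X)]
    (η : Measure C(Icc (0 : ℝ) T, X)) : Prop :=
  ∀ f : A, ∀ᵐ γ ∂η, SolvesODE hT R f γ

end Families

/-- The evaluation map `e_t` on `C([0, T]; X)`. -/
def evalAt [TopologicalSpace X] {T : ℝ} (t : Icc (0 : ℝ) T) (γ : C(Icc (0 : ℝ) T, X)) : X := γ t

/-- The initial time, as a point of `[0, T]`. -/
def time0 {T : ℝ} (hT : 0 < T) : Icc (0 : ℝ) T := ⟨0, left_mem_Icc.2 hT.le⟩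

/-- The family of probability measures `x ↦ κ x` consists of the conditional measures of `η`
induced by `e₀`: `η = ∫ κ x d(e₀)_# η(x)`, and `κ x` is concentrated on `{γ(0) = x}` for
`(e₀)_# η`-a.e. `x`. -/
def IsDisintegration [TopologicalSpace X] {T : ℝ} (hT : 0 < T)
    [MeasurableSpace C(Icc (0 : ℝ) T, X)] (η : Measure C(Icc (0 : ℝ) T, X))
    (κ : Kernel X C(Icc (0 : ℝ) T, X)) : Prop :=
  (∀ x, IsProbabilityMeasure (κ x)) ∧
    η = (η.map (evalAt (time0 hT))).bind κ ∧
    ∀ᵐ x ∂(η.map (evalAt (time0 hT))), ∀ᵐ γ ∂(κ x), evalAt (time0 hT) γ = x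

end NoSplitting

end

/-
For a weight `0 ≤ W ≤ 1` the marginals `u_s m = (e_s)_# (W η)` solve the continuity equation, by
the chain rule along the curves, so that uniqueness makes the marginal at time `0` determine all
the others. Apply this to the two weights `1_{γ(s) ∈ E}` and `P(γ(s) ∈ E | γ(0))`: they have the
same marginal at time `0`, hence at time `s`, and comparing the masses of `E` shows that
`P(γ(s) ∈ E | γ(0)) = 1` whenever `γ(s) ∈ E`. Thus the law of `γ(s)` given `γ(0)` takes only the
values `0` and `1`, for a dense set of times and a separating family of sets `E`, so it is a Dirac
mass.

The delicate point is the initial time. A curve solves the ODE only through the continuous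
representatives of `f ∘ γ`, which could differ from `f ∘ γ` at time `0`. The representatives define
operators `L_s : L²(m) → L²(η)`, continuous in `s`, with `L_s g = g ∘ e_s` for a.e. `s`, and what
solves the continuity equation is `s ↦ L_s* W`. That `L_0 g = g ∘ e_0` is again a consequence of
uniqueness: for a fixed positive `h ∈ L²(m)`, `h(γ(0)) L_0 g = (L_0 h) g(γ(0))`, and `L_0` respects
products, so `L_0 g = χ (g ∘ e_0)` with `χ ∈ {0, 1}`; the weight `1_{L_0 h = 0}` has zero marginal
at time `0`, hence at all times, so it vanishes and `χ = 1`.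
-/

noncomputable section

namespace NoSplitting

open scoped InnerProductSpace

/-! ### Sobolev functions on an interval -/

theorem integrableOn_continuous_mul {a b : ℝ} {φ f : ℝ → ℝ} (hφ : Continuous φ)
    (hf : IntegrableOn f (Ioo a b)) : IntegrableOn (fun t => φ t * f t) (Ioo a b) :=
  hf.continuousOn_mul_of_subset hφ.continuousOn isCompact_Icc measurableSet_Ioo
    Ioo_subset_Icc_self

theorem exists_contDiff_deriv_eq_of_integral_eq_zero {a b : ℝ} {ρ : ℝ → ℝ} (hρ : Continuous ρ)
    (hρs : ∀ t ∉ Icc a b, ρ t = 0) (hρ0 : ∫ t, ρ t = 0) :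
    ∃ ψ : ℝ → ℝ, ContDiff ℝ 1 ψ ∧ deriv ψ = ρ ∧ tsupport ψ ⊆ Icc a b := by
  have hρi : Integrable ρ :=
    hρ.integrable_of_hasCompactSupport (HasCompactSupport.intro isCompact_Icc hρs)
  set ψ : ℝ → ℝ := fun t => ∫ s in Iic t, ρ s
  have hψd (t : ℝ) : HasDerivAt ψ (ρ t) t := by
    have hψ : ψ = fun t => (∫ s in (0 : ℝ)..t, ρ s) + ∫ s in Iic (0 : ℝ), ρ s := funext fun t =>
      eq_add_of_sub_eq
        (intervalIntegral.integral_Iic_sub_Iic hρi.integrableOn hρi.integrableOn)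
    rw [hψ]
    exact (intervalIntegral.integral_hasDerivAt_right (hρ.intervalIntegrable _ _)
      hρ.stronglyMeasurable.stronglyMeasurableAtFilter hρ.continuousAt).add_const _
  have hψ' : deriv ψ = ρ := funext fun t => (hψd t).deriv
  have hψs : ∀ t ∉ Icc a b, ψ t = 0 := by
    intro t ht
    rcases lt_or_ge t a with hta | hat
    · exact setIntegral_eq_zero_of_forall_eq_zero fun s hs =>
        hρs s fun hsI => hsI.1.not_gt (lt_of_le_of_lt hs hta)
    · have hbt : b < t := not_le.1 fun htb => ht ⟨hat, htb⟩
      rw [← hρ0]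
      exact setIntegral_eq_integral_of_forall_compl_eq_zero fun s hs =>
        hρs s fun hsI => hs (hsI.2.trans hbt.le)
  refine ⟨ψ, ?_, hψ', closure_minimal (fun t ht => by_contra fun h => ht (hψs t h)) isClosed_Icc⟩
  rw [contDiff_one_iff_deriv, hψ']
  exact ⟨fun t => (hψd t).differentiableAt, hρ⟩

theorem exists_subset_Icc_subset_Ioo {a b : ℝ} (hab : a < b) {K : Set ℝ} (hK : IsCompact K)
    (hKs : K ⊆ Ioo a b) : ∃ c d, K ⊆ Icc c d ∧ Icc c d ⊆ Ioo a b := by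
  have hmid : (a + b) / 2 ∈ Ioo a b := ⟨by linarith, by linarith⟩
  have hK' := hK.insert ((a + b) / 2)
  have hKs' := insert_subset hmid hKs
  obtain ⟨c, hcK, hc⟩ := hK'.exists_isLeast (insert_nonempty _ _)
  obtain ⟨d, hdK, hd⟩ := hK'.exists_isGreatest (insert_nonempty _ _)
  exact ⟨c, d, fun x hx => ⟨hc (mem_insert_of_mem _ hx), hd (mem_insert_of_mem _ hx)⟩,
    Icc_subset_Ioo (hKs' hcK).1 (hKs' hdK).2⟩

theorem exists_contDiff_tsupport_subset_Ioo_integral_eq_one {a b : ℝ} (hab : a < b) :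
    ∃ φ : ℝ → ℝ, ContDiff ℝ (⊤ : ℕ∞) φ ∧ HasCompactSupport φ ∧ tsupport φ ⊆ Ioo a b ∧
      ∫ t, φ t = 1 := by
  let B : ContDiffBump ((a + b) / 2) :=
    ⟨(b - a) / 8, (b - a) / 4, by linarith, by linarith⟩
  refine ⟨B.normed volume, B.contDiff_normed, B.hasCompactSupport_normed, ?_, B.integral_normed⟩
  rw [B.tsupport_normed_eq, Real.closedBall_eq_Icc]
  exact Icc_subset_Ioo (by change a < (a + b) / 2 - (b - a) / 4; linarith)
    (by change (a + b) / 2 + (b - a) / 4 < b; linarith)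

/-- The du Bois-Reymond lemma. -/
theorem exists_ae_eq_const_of_forall_integral_deriv_mul_eq_zero {a b : ℝ} (hab : a < b)
    {g : ℝ → ℝ} (hg : IntegrableOn g (Ioo a b))
    (h : ∀ ψ : ℝ → ℝ, ContDiff ℝ 1 ψ → HasCompactSupport ψ → tsupport ψ ⊆ Ioo a b →
      ∫ t in Ioo a b, deriv ψ t * g t = 0) :
    ∃ c : ℝ, ∀ᵐ t ∂(volume.restrict (Ioo a b)), g t = c := by
  obtain ⟨φ₀, hφ₀, hφ₀c, hφ₀s, hφ₀i⟩ := exists_contDiff_tsupport_subset_Ioo_integral_eq_one hab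
  set c := ∫ t in Ioo a b, φ₀ t * g t
  refine ⟨c, ?_⟩
  have hgc : IntegrableOn (fun t => g t - c) (Ioo a b) := hg.sub (integrableOn_const (by simp))
  suffices ∀ᵐ t, t ∈ Ioo a b → g t - c = 0 by
    rw [ae_restrict_iff' measurableSet_Ioo]
    filter_upwards [this] with t ht hts using sub_eq_zero.1 (ht hts)
  refine isOpen_Ioo.ae_eq_zero_of_integral_contDiff_smul_eq_zero hgc.locallyIntegrableOn
    fun φ hφ hφc hφs => ?_
  have hφi := hφ.continuous.integrable_of_hasCompactSupport (μ := volume) hφc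
  have hφ₀' := hφ₀.continuous.integrable_of_hasCompactSupport (μ := volume) hφ₀c
  obtain ⟨a', b', hs, hI⟩ := exists_subset_Icc_subset_Ioo hab
    (hφc.isCompact.union hφ₀c.isCompact) (union_subset hφs hφ₀s)
  obtain ⟨ψ, hψ, hψ', hψs⟩ := exists_contDiff_deriv_eq_of_integral_eq_zero
    (a := a') (b := b') (ρ := fun t => φ t - (∫ s, φ s) * φ₀ t)
    (hφ.continuous.sub (hφ₀.continuous.const_mul _))
    (fun t ht => by
      rw [image_eq_zero_of_notMem_tsupport fun h => ht (hs (.inl h)),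
        image_eq_zero_of_notMem_tsupport fun h => ht (hs (.inr h)), mul_zero, sub_zero])
    (by rw [integral_sub hφi (hφ₀'.const_mul _), integral_const_mul, hφ₀i, mul_one, sub_self])
  have hφg : ∫ t in Ioo a b, φ t * g t = (∫ t, φ t) * c := by
    have := h ψ hψ (isCompact_Icc.of_isClosed_subset (isClosed_tsupport ψ) hψs) (hψs.trans hI)
    simp only [hψ', sub_mul, mul_assoc] at this
    rwa [integral_sub (integrableOn_continuous_mul hφ.continuous hg)
      ((integrableOn_continuous_mul hφ₀.continuous hg).const_mul _), integral_const_mul,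
      sub_eq_zero] at this
  have hIoo (f : ℝ → ℝ) : ∫ t, φ t * f t = ∫ t in Ioo a b, φ t * f t :=
    (setIntegral_eq_integral_of_forall_compl_eq_zero fun t ht => by
      rw [image_eq_zero_of_notMem_tsupport fun h => ht (hφs h), zero_mul]).symm
  calc ∫ t, φ t • (g t - c) = ∫ t in Ioo a b, φ t * (g t - c) := hIoo _
    _ = (∫ t in Ioo a b, φ t * g t) - ∫ t in Ioo a b, φ t * c := by
      simp only [mul_sub]
      exact integral_sub (integrableOn_continuous_mul hφ.continuous hg)
        (hφi.integrableOn.mul_const _)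
    _ = 0 := by rw [hφg, ← hIoo, integral_mul_const, sub_self]

section Primitive

variable {T : ℝ} {k ψ : ℝ → ℝ}

theorem continuousOn_primitive_Icc (hT : 0 ≤ T) (hk : IntegrableOn k (Ioo 0 T)) :
    ContinuousOn (fun t => ∫ r in (0 : ℝ)..t, k r) (Icc 0 T) := by
  have := intervalIntegral.continuousOn_primitive_interval (f := k) (a := 0) (b := T) (μ := volume)
    (by rwa [uIcc_of_le hT, integrableOn_Icc_iff_integrableOn_Ioo])
  rwa [uIcc_of_le hT] at this

theorem integrableOn_primitive (hT : 0 ≤ T) (hk : IntegrableOn k (Ioo 0 T)) :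
    IntegrableOn (fun t => ∫ r in (0 : ℝ)..t, k r) (Ioo 0 T) :=
  (continuousOn_primitive_Icc hT hk).integrableOn_Icc.mono_set Ioo_subset_Icc_self

theorem integral_deriv_mul_primitive_add (hT : 0 ≤ T) (hk : IntegrableOn k (Ioo 0 T))
    (hψ : ContDiff ℝ 1 ψ) :
    ∫ t in Ioo 0 T, (deriv ψ t * (∫ r in (0 : ℝ)..t, k r) + ψ t * k t)
      = ψ T * ∫ r in (0 : ℝ)..T, k r := by
  have hki : IntervalIntegrable k volume 0 T :=
    (intervalIntegrable_iff_integrableOn_Ioo_of_le hT).2 hk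
  have h := AbsolutelyContinuousOnInterval.integral_deriv_mul_eq_sub
    (hψ.contDiffOn.absolutelyContinuousOnInterval (a := 0) (b := T))
    (hki.absolutelyContinuousOnInterval_intervalIntegral left_mem_uIcc)
  rw [intervalIntegral.integral_same, mul_zero, sub_zero] at h
  rw [← h, intervalIntegral.integral_of_le hT, integral_Ioc_eq_integral_Ioo]
  refine integral_congr_ae ?_
  rw [EventuallyEq, ae_restrict_iff' measurableSet_Ioo]
  filter_upwards [hki.ae_hasDerivAt_integral] with t ht htI
  have htT : t ∈ uIcc 0 T := by rw [uIcc_of_le hT]; exact Ioo_subset_Icc_self htI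
  rw [(ht htT 0 left_mem_uIcc).deriv]

theorem integral_deriv_Ioo {a b : ℝ} (hab : a ≤ b) (hψ : ContDiff ℝ 1 ψ) :
    ∫ t in Ioo a b, deriv ψ t = ψ b - ψ a := by
  rw [← integral_Ioc_eq_integral_Ioo, ← intervalIntegral.integral_of_le hab]
  exact intervalIntegral.integral_deriv_eq_sub (fun t _ => hψ.differentiable one_ne_zero t)
    ((hψ.continuous_deriv le_rfl).intervalIntegrable _ _)

theorem integral_deriv_mul_add_of_ae_eq (hT : 0 ≤ T) {h : ℝ → ℝ} {c : ℝ}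
    (hk : IntegrableOn k (Ioo 0 T))
    (hc : ∀ᵐ t ∂(volume.restrict (Ioo 0 T)), h t = c + ∫ r in (0 : ℝ)..t, k r)
    (hψ : ContDiff ℝ 1 ψ) (hψT : ψ T = 0) :
    ∫ t in Ioo 0 T, (deriv ψ t * h t + ψ t * k t) = -(ψ 0 * c) := by
  have hψ' := hψ.continuous_deriv le_rfl
  calc ∫ t in Ioo 0 T, (deriv ψ t * h t + ψ t * k t)
      = ∫ t in Ioo 0 T, (deriv ψ t * c +
          (deriv ψ t * (∫ r in (0 : ℝ)..t, k r) + ψ t * k t)) := by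
        refine integral_congr_ae ?_
        filter_upwards [hc] with t ht
        rw [ht]; ring
    _ = (ψ T - ψ 0) * c + ψ T * ∫ r in (0 : ℝ)..T, k r := by
        have hi : IntegrableOn (fun t => deriv ψ t * (∫ r in (0 : ℝ)..t, k r) + ψ t * k t)
            (Ioo 0 T) :=
          (integrableOn_continuous_mul hψ' (integrableOn_primitive hT hk)).add
            (integrableOn_continuous_mul hψ.continuous hk)
        rw [integral_add (integrableOn_continuous_mul hψ' (integrableOn_const (by simp))) hi,
          integral_deriv_mul_primitive_add hT hk hψ, integral_mul_const,
          integral_deriv_Ioo hT hψ]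
    _ = -(ψ 0 * c) := by rw [hψT]; ring

end Primitive

/-- The value at `0` of the continuous representative of a function `h ∈ W^{1,1}(0, T)` with weak
derivative `k`. It is written as an integral, so that it depends measurably on parameters. -/
def initialValue (T : ℝ) (h k : ℝ → ℝ) : ℝ := T⁻¹ * ∫ t in Ioo 0 T, (h t + (t - T) * k t)

theorem exists_ae_eq_const_add_primitive {T : ℝ} (hT : 0 < T) {h k : ℝ → ℝ}
    (H : HasW11Deriv T h k) :
    ∃ c : ℝ, ∀ᵐ t ∂(volume.restrict (Ioo 0 T)), h t = c + ∫ r in (0 : ℝ)..t, k r := by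
  obtain ⟨hh, hk, hw⟩ := H
  have hprim := integrableOn_primitive hT.le hk
  obtain ⟨c, hc⟩ := exists_ae_eq_const_of_forall_integral_deriv_mul_eq_zero hT
    (hh.sub hprim) fun ψ hψ hψc hψs => by
      have hψ' := hψ.continuous_deriv le_rfl
      have hψT : ψ T = 0 := image_eq_zero_of_notMem_tsupport fun h => lt_irrefl T (hψs h).2
      have hparts := integral_deriv_mul_primitive_add hT.le hk hψ
      rw [hψT, zero_mul, integral_add (integrableOn_continuous_mul hψ' hprim)
        (integrableOn_continuous_mul hψ.continuous hk)] at hparts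
      simp only [Pi.sub_apply, mul_sub]
      rw [integral_sub (integrableOn_continuous_mul hψ' hh)
        (integrableOn_continuous_mul hψ' hprim), hw ψ hψ hψc hψs]
      linarith
  exact ⟨c, hc.mono fun t ht => eq_add_of_sub_eq ht⟩

theorem ae_eq_initialValue_add_primitive {T : ℝ} (hT : 0 < T) {h k : ℝ → ℝ}
    (H : HasW11Deriv T h k) :
    ∀ᵐ t ∂(volume.restrict (Ioo 0 T)), h t = initialValue T h k + ∫ r in (0 : ℝ)..t, k r := by
  obtain ⟨c, hc⟩ := exists_ae_eq_const_add_primitive hT H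
  have hTc := integral_deriv_mul_add_of_ae_eq hT.le H.2.1 hc
    (contDiff_id.sub (contDiff_const (c := T))) (sub_self T)
  have hderiv (t : ℝ) : deriv (fun t : ℝ => t - T) t = 1 := by simp
  have : initialValue T h k = c := by
    rw [initialValue]
    simp only [id, hderiv, one_mul, zero_sub] at hTc
    rw [hTc]
    field_simp
  rwa [this]

/-! ### Strongly continuous families of operators -/

theorem forall_mem_of_ae_mem {S Y : Type*} [TopologicalSpace S] [MeasurableSpace S]
    [TopologicalSpace Y] (μ : Measure S) [μ.IsOpenPosMeasure] {F : S → Y} (hF : Continuous F)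
    {C : Set Y} (hC : IsClosed C) (h : ∀ᵐ s ∂μ, F s ∈ C) (s : S) : F s ∈ C :=
  closure_minimal (fun _ hs => hs) (hC.preimage hF) (μ.dense_of_ae h s)

theorem continuousMap_eq_of_ae_eq {S Y : Type*} [TopologicalSpace S] [MeasurableSpace S]
    [TopologicalSpace Y] [T2Space Y] (μ : Measure S) [μ.IsOpenPosMeasure] {F G : C(S, Y)}
    (h : F =ᵐ[μ] G) : F = G :=
  ContinuousMap.coe_injective (μ.eq_of_ae_eq h F.continuous G.continuous)

section StronglyContinuous

variable {S H K : Type*} [TopologicalSpace S] [CompactSpace S] [MeasurableSpace S]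
  {μ : Measure S} [μ.IsOpenPosMeasure] [NormedAddCommGroup H] [NormedSpace ℝ H]
  [NormedAddCommGroup K] [NormedSpace ℝ K]

theorem exists_linearMap_continuousMap (A : Submodule ℝ H) (P : S → H →L[ℝ] K) (M : ℝ≥0)
    (hP : ∀ s, ‖P s‖ ≤ M) (hF : ∀ f ∈ A, ∃ F : C(S, K), ∀ᵐ s ∂μ, F s = P s f) :
    ∃ Φ : A →ₗ[ℝ] C(S, K), (∀ f : A, ∀ᵐ s ∂μ, Φ f s = P s f) ∧ ∀ f, ‖Φ f‖ ≤ M * ‖A.subtype f‖ := by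
  choose F hF using fun f : A => hF f f.2
  let Φ : A →ₗ[ℝ] C(S, K) :=
    { toFun := F
      map_add' := fun f g => continuousMap_eq_of_ae_eq μ (by
        filter_upwards [hF f, hF g, hF (f + g)] with s hf hg hfg
        rw [hfg, ContinuousMap.add_apply, hf, hg, Submodule.coe_add, map_add])
      map_smul' := fun r f => continuousMap_eq_of_ae_eq μ (by
        filter_upwards [hF f, hF (r • f)] with s hf hrf
        rw [hrf, RingHom.id_apply, ContinuousMap.smul_apply, hf, Submodule.coe_smul, map_smul]) }
  refine ⟨Φ, hF, fun f => (ContinuousMap.norm_le _ (by positivity)).2 fun s => ?_⟩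
  rw [← mem_closedBall_zero_iff]
  refine forall_mem_of_ae_mem μ (F f).continuous Metric.isClosed_closedBall ?_ s
  filter_upwards [hF f] with r hr
  rw [hr, mem_closedBall_zero_iff]
  exact (P r).le_of_opNorm_le (hP r) f

theorem exists_stronglyContinuous_extension [SecondCountableTopology H] [CompleteSpace K]
    {A : Submodule ℝ H} (hA : Dense (A : Set H)) (P : S → H →L[ℝ] K) (M : ℝ≥0)
    (hP : ∀ s, ‖P s‖ ≤ M) (hF : ∀ f ∈ A, ∃ F : C(S, K), ∀ᵐ s ∂μ, F s = P s f) :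
    ∃ L : H →L[ℝ] C(S, K), ∀ᵐ s ∂μ, ∀ g, L g s = P s g := by
  obtain ⟨Φ, hΦ, hΦM⟩ := exists_linearMap_continuousMap A P M hP hF
  have hdense : DenseRange A.subtype := by
    rwa [DenseRange, Submodule.coe_subtype, Subtype.range_coe]
  set L := Φ.extendOfNorm A.subtype
  have hL (f : A) : L f = Φ f := LinearMap.extendOfNorm_eq hdense ⟨M, hΦM⟩ f
  obtain ⟨D, hDc, hD⟩ := TopologicalSpace.exists_countable_dense A
  have hLD : ∀ᵐ s ∂μ, ∀ f ∈ D, L (f : H) s = P s f := by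
    rw [ae_ball_iff hDc]
    intro f _
    filter_upwards [hΦ f] with s hs
    rw [hL, hs]
  refine ⟨L, ?_⟩
  filter_upwards [hLD] with s hs g
  have hLs : Continuous fun g => L g s := (continuous_eval_const s).comp L.continuous
  refine congrFun (hLs.ext_on (hdense.dense_image continuous_subtype_val hD)
    (P s).continuous ?_) g
  rintro _ ⟨f, hf, rfl⟩
  exact hs f hf

end StronglyContinuous

section CompOp

variable {X Ω E : Type*} [MeasurableSpace X] [MeasurableSpace Ω] {m : Measure X} {η : Measure Ω}
  [NormedAddCommGroup E] {p : ℝ≥0∞} {e : Ω → X} {c : ℝ≥0}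

theorem quasiMeasurePreserving_of_map_le_smul (he : Measurable e)
    (h : η.map e ≤ (c : ℝ≥0∞) • m) : Measure.QuasiMeasurePreserving e η m :=
  ⟨he, Measure.absolutelyContinuous_of_le_smul h⟩

theorem memLp_comp_of_map_le_smul (he : Measurable e) (h : η.map e ≤ (c : ℝ≥0∞) • m) {g : X → E}
    (hg : MemLp g p m) : MemLp (g ∘ e) p η :=
  (hg.of_measure_le_smul ENNReal.coe_ne_top h).comp_of_map he.aemeasurable

theorem eLpNorm_comp_le_of_map_le_smul (he : Measurable e) (h : η.map e ≤ (c : ℝ≥0∞) • m)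
    {g : X → E} (hg : AEStronglyMeasurable g m) :
    eLpNorm (g ∘ e) p η ≤ (c : ℝ≥0∞) ^ (1 / p).toReal * eLpNorm g p m := by
  rw [← eLpNorm_map_measure
    (hg.mono_ac (Measure.absolutelyContinuous_of_le_smul h)) he.aemeasurable]
  exact (eLpNorm_mono_measure _ h).trans (eLpNorm_smul_measure_le _ _ _ _)

theorem norm_toLp_comp_le_of_map_le_smul (he : Measurable e) (h : η.map e ≤ (c : ℝ≥0∞) • m)
    (g : Lp E p m) :
    ‖(memLp_comp_of_map_le_smul he h (Lp.memLp g)).toLp (g ∘ e)‖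
      ≤ ((c : ℝ≥0∞) ^ (1 / p).toReal).toReal * ‖g‖ := by
  rw [Lp.norm_toLp, Lp.norm_def, ← ENNReal.toReal_mul]
  exact ENNReal.toReal_mono (ENNReal.mul_ne_top
    (ENNReal.rpow_ne_top_of_nonneg ENNReal.toReal_nonneg ENNReal.coe_ne_top)
    (Lp.memLp g).2.ne) (eLpNorm_comp_le_of_map_le_smul he h (Lp.memLp g).1)

variable [NormedSpace ℝ E] [Fact (1 ≤ p)]

/-- The composition operator `g ↦ g ∘ e` from `Lᵖ(m)` to `Lᵖ(η)`, when `e_# η ≤ c m`. -/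
def compOp (he : Measurable e) (h : η.map e ≤ (c : ℝ≥0∞) • m) : Lp E p m →L[ℝ] Lp E p η :=
  have hmem (g : Lp E p m) : MemLp (g ∘ e) p η := memLp_comp_of_map_le_smul he h (Lp.memLp g)
  have hqmp := quasiMeasurePreserving_of_map_le_smul he h
  LinearMap.mkContinuous
    { toFun := fun g => (hmem g).toLp _
      map_add' := fun f g =>
        MemLp.toLp_congr _ ((hmem f).add (hmem g)) (hqmp.ae_eq (Lp.coeFn_add f g))
      map_smul' := fun r f =>
        MemLp.toLp_congr _ ((hmem f).const_smul r) (hqmp.ae_eq (Lp.coeFn_smul r f)) }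
    ((c : ℝ≥0∞) ^ (1 / p).toReal).toReal (norm_toLp_comp_le_of_map_le_smul he h)

theorem coeFn_compOp (he : Measurable e) (h : η.map e ≤ (c : ℝ≥0∞) • m) (g : Lp E p m) :
    compOp he h g =ᵐ[η] g ∘ e :=
  MemLp.coeFn_toLp (memLp_comp_of_map_le_smul he h (Lp.memLp g))

theorem norm_compOp_le (he : Measurable e) (h : η.map e ≤ (c : ℝ≥0∞) • m) :
    ‖(compOp he h : Lp E p m →L[ℝ] Lp E p η)‖ ≤ ((c : ℝ≥0∞) ^ (1 / p).toReal).toReal :=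
  ContinuousLinearMap.opNorm_le_bound _ ENNReal.toReal_nonneg
    (norm_toLp_comp_le_of_map_le_smul he h)

end CompOp

theorem continuous_toLp_of_bounded {Ω S E : Type*} [MeasurableSpace Ω] {η : Measure Ω}
    [IsFiniteMeasure η] [TopologicalSpace S] [SequentialSpace S] [NormedAddCommGroup E]
    {p : ℝ≥0∞} [Fact (1 ≤ p)] (hp : p ≠ ∞) {G : S → Ω → E} (hG : ∀ s, MemLp (G s) p η) {M : ℝ}
    (hM : ∀ s, ∀ᵐ γ ∂η, ‖G s γ‖ ≤ M) (hcont : ∀ᵐ γ ∂η, Continuous fun s => G s γ) :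
    Continuous fun s => (hG s).toLp (G s) := by
  rw [continuous_iff_seqContinuous]
  intro u s hu
  refine (Lp.tendsto_Lp_iff_tendsto_eLpNorm'' _ (fun n => hG (u n)) _ (hG s)).2
    (tendsto_Lp_finite_of_tendsto_ae Fact.out hp (fun n => (hG (u n)).1) (hG s) ?_ ?_)
  · refine unifIntegrable_of Fact.out hp (fun n => (hG (u n)).1) fun ε _ =>
      ⟨‖M‖₊ + 1, fun n => ?_⟩
    rw [eLpNorm_congr_ae (g := 0), eLpNorm_zero]
    · simp
    filter_upwards [hM (u n)] with γ hγ
    refine indicator_of_notMem (fun h => ?_) _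
    have : |M| + 1 ≤ ‖G (u n) γ‖ := by exact_mod_cast h
    linarith [le_abs_self M]
  · filter_upwards [hcont] with γ hγ using (hγ.tendsto s).comp hu

/-! ### Evaluation of curves under measures of bounded compression -/

section Evaluation

variable {S X : Type*} [TopologicalSpace S] [TopologicalSpace X] [MeasurableSpace X]
  [MeasurableSpace C(S, X)] {m : Measure X} {η : Measure C(S, X)} {c : ℝ≥0}

/-- The marginals of the measure `η` on the path space `C(S, X)` are all bounded by `c m`. -/
def BoundedCompression (η : Measure C(S, X)) (m : Measure X) (c : ℝ≥0) : Prop :=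
  ∀ s, η.map (fun γ => γ s) ≤ (c : ℝ≥0∞) • m

variable [BorelSpace X] [BorelSpace C(S, X)]

theorem measurable_eval (s : S) : Measurable fun γ : C(S, X) => γ s :=
  (continuous_eval_const s).measurable

theorem measurable_eval_prod [LocallyCompactSpace S] [SecondCountableTopology S]
    [MeasurableSpace S] [BorelSpace S] [SecondCountableTopology X] :
    Measurable fun z : S × C(S, X) => z.2 z.1 :=
  have : SecondCountableTopology C(S, X) := inferInstance
  (by fun_prop : Continuous fun z : S × C(S, X) => z.2 z.1).measurable

namespace BoundedCompression

theorem quasiMeasurePreserving (hc : BoundedCompression η m c) (s : S) :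
    Measure.QuasiMeasurePreserving (fun γ : C(S, X) => γ s) η m :=
  quasiMeasurePreserving_of_map_le_smul (measurable_eval s) (hc s)

theorem ae_eval (hc : BoundedCompression η m c) {p : X → Prop} (h : ∀ᵐ x ∂m, p x) (s : S) :
    ∀ᵐ γ ∂η, p (γ s) :=
  (hc.quasiMeasurePreserving s).ae h

/-- The operator `g ↦ (γ ↦ g (γ s))` from `L²(m)` to `L²(η)`. -/
def evalOp (hc : BoundedCompression η m c) (s : S) : Lp ℝ 2 m →L[ℝ] Lp ℝ 2 η :=
  compOp (measurable_eval s) (hc s)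

theorem coeFn_evalOp (hc : BoundedCompression η m c) (s : S) (g : Lp ℝ 2 m) :
    hc.evalOp s g =ᵐ[η] fun γ => g (γ s) :=
  coeFn_compOp (measurable_eval s) (hc s) g

theorem inner_evalOp_indicator (hc : BoundedCompression η m c) (s : S) {B : Set X}
    (hB : MeasurableSet B) (hmB : m B ≠ ∞) (W : Lp ℝ 2 η) :
    ⟪hc.evalOp s (indicatorConstLp 2 hB hmB 1), W⟫_ℝ = ∫ γ in (fun γ => γ s) ⁻¹' B, W γ ∂η := by
  rw [L2.inner_def, ← integral_indicator (measurable_eval s hB)]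
  refine integral_congr_ae ?_
  filter_upwards [hc.coeFn_evalOp s (indicatorConstLp 2 hB hmB 1),
    hc.ae_eval (indicatorConstLp_coeFn (p := 2) (hs := hB) (hμs := hmB) (c := (1 : ℝ))) s]
    with γ hγ hγB
  rw [hγ, hγB]
  by_cases h : γ s ∈ B <;> simp [h]

end BoundedCompression

end Evaluation

instance polishSpace_continuousMap {S X : Type*} [TopologicalSpace S] [CompactSpace S] [T2Space S]
    [SecondCountableTopology S] [TopologicalSpace X] [PolishSpace X] : PolishSpace C(S, X) := by
  let _ := TopologicalSpace.upgradeIsCompletelyMetrizable X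
  infer_instance

/-! ### The flow of operators along curves of class `W^{1,1}` -/

attribute [local instance] Measure.Subtype.measureSpace

section TimeInterval

variable {T : ℝ}

theorem ae_Icc_iff (hT : 0 ≤ T) {p : Icc (0 : ℝ) T → Prop} :
    (∀ᵐ s, p s) ↔ ∀ᵐ t ∂(volume.restrict (Ioo 0 T)), p (projIcc 0 T hT t) := by
  rw [restrict_Ioo_eq_restrict_Icc, ae_restrict_iff_subtype measurableSet_Icc]
  simp only [projIcc_val]
  rfl

instance isFiniteMeasure_Icc : IsFiniteMeasure (volume : Measure (Icc (0 : ℝ) T)) :=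
  ⟨by
    rw [Measure.Subtype.volume_univ measurableSet_Icc.nullMeasurableSet]
    exact measure_Icc_lt_top⟩

theorem isOpenPosMeasure_Icc (hT : 0 < T) :
    (volume : Measure (Icc (0 : ℝ) T)).IsOpenPosMeasure := by
  refine ⟨fun U hU ⟨s, hs⟩ => ?_⟩
  obtain ⟨V, hV, rfl⟩ := isOpen_induced_iff.1 hU
  have hs' : (s : ℝ) ∈ closure (Ioo 0 T) := by rw [closure_Ioo hT.ne]; exact s.2
  have hne : (V ∩ Ioo 0 T).Nonempty := mem_closure_iff.1 hs' V hV hs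
  refine ((hV.inter isOpen_Ioo).measure_pos volume hne).trans_le ?_ |>.ne'
  rw [Measure.Subtype.volume_def, comap_subtype_coe_apply measurableSet_Icc,
    Subtype.image_preimage_coe, inter_comm]
  gcongr
  exact Ioo_subset_Icc_self

end TimeInterval

section ContRep

variable {X : Type*} [TopologicalSpace X] {T : ℝ} {hT : 0 < T} {φ : X → ℝ} {v : ℝ × X → ℝ}
  {γ : C(Icc (0 : ℝ) T, X)}

/-- `φ ∘ γ ∈ W^{1,1}(0, T)`, with derivative `t ↦ v (t, γ t)`. -/
def HasVelocityAlong (hT : 0 < T) (φ : X → ℝ) (v : ℝ × X → ℝ) (γ : C(Icc (0 : ℝ) T, X)) : Prop :=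
  HasW11Deriv T (fun t => φ (IccExtend hT.le γ t)) (fun t => v (t, IccExtend hT.le γ t))

/-- The value at time `0` of the absolutely continuous representative of `φ ∘ γ`, when `φ ∘ γ` has
derivative `t ↦ v (t, γ t)`. -/
def initialValueAlong (hT : 0 < T) (φ : X → ℝ) (v : ℝ × X → ℝ) (γ : C(Icc (0 : ℝ) T, X)) : ℝ :=
  initialValue T (fun t => φ (IccExtend hT.le γ t)) (fun t => v (t, IccExtend hT.le γ t))

/-- The absolutely continuous representative of `φ ∘ γ`, when `φ ∘ γ` has derivative
`t ↦ v (t, γ t)`. -/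
def contRep (hT : 0 < T) (φ : X → ℝ) (v : ℝ × X → ℝ) (s : Icc (0 : ℝ) T)
    (γ : C(Icc (0 : ℝ) T, X)) : ℝ :=
  initialValueAlong hT φ v γ + ∫ r in (0 : ℝ)..s, v (r, IccExtend hT.le γ r)

theorem contRep_time0 : contRep hT φ v (time0 hT) = initialValueAlong hT φ v := by
  funext γ
  simp only [contRep, time0, intervalIntegral.integral_same, add_zero]

namespace HasVelocityAlong

theorem continuous_contRep (h : HasVelocityAlong hT φ v γ) :
    Continuous fun s => contRep hT φ v s γ :=
  continuous_const.add (continuousOn_primitive_Icc hT.le h.2.1).domRestrict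

theorem ae_eq_primitive (h : HasVelocityAlong hT φ v γ) :
    ∀ᵐ t ∂(volume.restrict (Ioo 0 T)), φ (IccExtend hT.le γ t) =
      initialValueAlong hT φ v γ + ∫ r in (0 : ℝ)..t, v (r, IccExtend hT.le γ r) :=
  ae_eq_initialValue_add_primitive hT h

theorem ae_eq_contRep (h : HasVelocityAlong hT φ v γ) : ∀ᵐ s, φ (γ s) = contRep hT φ v s γ := by
  rw [ae_Icc_iff hT.le]
  filter_upwards [h.ae_eq_primitive, self_mem_ae_restrict measurableSet_Ioo] with t ht htI
  rw [contRep, projIcc_of_mem hT.le (Ioo_subset_Icc_self htI), ← ht,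
    IccExtend_of_mem hT.le _ (Ioo_subset_Icc_self htI)]

end HasVelocityAlong

variable [PolishSpace X] [MeasurableSpace X] [BorelSpace X]
  [MeasurableSpace C(Icc (0 : ℝ) T, X)] [BorelSpace C(Icc (0 : ℝ) T, X)]

variable (hT) in
theorem measurable_iccExtend_prod :
    Measurable fun z : ℝ × C(Icc (0 : ℝ) T, X) => IccExtend hT.le z.2 z.1 :=
  measurable_eval_prod.comp (f := fun z : ℝ × C(Icc (0 : ℝ) T, X) => (projIcc 0 T hT.le z.1, z.2))
    ((continuous_projIcc.measurable.comp measurable_fst).prodMk measurable_snd)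

variable (hT) in
theorem measurable_comp_iccExtend (hv : Measurable v) :
    Measurable fun z : ℝ × C(Icc (0 : ℝ) T, X) => v (z.1, IccExtend hT.le z.2 z.1) :=
  hv.comp (measurable_fst.prodMk (measurable_iccExtend_prod hT))

theorem measurable_initialValueAlong (hφ : Measurable φ) (hv : Measurable v) :
    Measurable (initialValueAlong hT φ v) := by
  have h : Measurable fun z : ℝ × C(Icc (0 : ℝ) T, X) =>
      φ (IccExtend hT.le z.2 z.1) + (z.1 - T) * v (z.1, IccExtend hT.le z.2 z.1) :=
    (hφ.comp (measurable_iccExtend_prod hT)).add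
      ((measurable_fst.sub_const T).mul (measurable_comp_iccExtend hT hv))
  exact (h.stronglyMeasurable.integral_prod_left'
    (μ := volume.restrict (Ioo 0 T))).measurable.const_mul _

theorem measurable_contRep (hφ : Measurable φ) (hv : Measurable v) :
    Measurable fun z : Icc (0 : ℝ) T × C(Icc (0 : ℝ) T, X) => contRep hT φ v z.1 z.2 := by
  refine ((measurable_initialValueAlong hφ hv).comp measurable_snd).add ?_
  have h : Measurable fun z : ℝ × (Icc (0 : ℝ) T × C(Icc (0 : ℝ) T, X)) =>
      {z : ℝ × (Icc (0 : ℝ) T × C(Icc (0 : ℝ) T, X)) | z.1 ∈ Ioc 0 (z.2.1 : ℝ)}.indicator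
        (fun z => v (z.1, IccExtend hT.le z.2.2 z.1)) z := by
    refine Measurable.indicator ((measurable_comp_iccExtend hT hv).comp
      (measurable_fst.prodMk measurable_snd.snd)) ?_
    exact (measurableSet_lt measurable_const measurable_fst).inter
      (measurableSet_le measurable_fst (measurable_subtype_coe.comp measurable_snd.fst))
  convert (h.stronglyMeasurable.integral_prod_left' (μ := volume)).measurable using 2 with z
  rw [intervalIntegral.integral_of_le z.1.2.1, ← integral_indicator measurableSet_Ioc]
  rfl

variable {m : Measure X} {η : Measure C(Icc (0 : ℝ) T, X)} [IsProbabilityMeasure η] {c : ℝ≥0}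
  {M : ℝ}

theorem ae_ae_eq_contRep (hφ : Measurable φ) (hv : Measurable v)
    (hη : ∀ᵐ γ ∂η, HasVelocityAlong hT φ v γ) :
    ∀ᵐ s, ∀ᵐ γ ∂η, φ (γ s) = contRep hT φ v s γ := by
  rw [Measure.ae_ae_comm (p := fun s γ => φ (γ s) = contRep hT φ v s γ)
    (measurableSet_eq_fun (hφ.comp measurable_eval_prod)
    (measurable_contRep hφ hv))]
  filter_upwards [hη] with γ hγ using hγ.ae_eq_contRep

theorem ae_forall_abs_contRep_le (hφ : Measurable φ) (hv : Measurable v)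
    (hη : ∀ᵐ γ ∂η, HasVelocityAlong hT φ v γ) (hc : BoundedCompression η m c)
    (hM : ∀ᵐ x ∂m, |φ x| ≤ M) : ∀ᵐ γ ∂η, ∀ s, |contRep hT φ v s γ| ≤ M := by
  have := isOpenPosMeasure_Icc hT
  have hle : ∀ᵐ s, ∀ᵐ γ ∂η, |contRep hT φ v s γ| ≤ M := by
    filter_upwards [ae_ae_eq_contRep hφ hv hη] with s hs
    filter_upwards [hs, hc.ae_eval hM s] with γ hγ hγM
    rwa [← hγ]
  rw [Measure.ae_ae_comm (p := fun s γ => |contRep hT φ v s γ| ≤ M)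
    (measurableSet_le (measurable_contRep hφ hv).abs measurable_const)] at hle
  filter_upwards [hle, hη] with γ hγ hγη
  exact forall_mem_of_ae_mem volume hγη.continuous_contRep
    (isClosed_le continuous_abs continuous_const) hγ

theorem exists_continuousMap_eval (hφ : Measurable φ) (hv : Measurable v)
    (hη : ∀ᵐ γ ∂η, HasVelocityAlong hT φ v γ) (hc : BoundedCompression η m c)
    (hM : ∀ᵐ x ∂m, |φ x| ≤ M) :
    ∃ F : C(Icc (0 : ℝ) T, Lp ℝ 2 η), (∀ᵐ s, F s =ᵐ[η] fun γ => φ (γ s)) ∧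
      F (time0 hT) =ᵐ[η] initialValueAlong hT φ v := by
  have hle := ae_forall_abs_contRep_le hφ hv hη hc hM
  have hmem (s : Icc (0 : ℝ) T) : MemLp (contRep hT φ v s) 2 η :=
    .of_bound ((measurable_contRep hφ hv).comp measurable_prodMk_left).aestronglyMeasurable M
      (hle.mono fun _ h => h s)
  refine ⟨⟨_, continuous_toLp_of_bounded ENNReal.ofNat_ne_top hmem
    (fun s => hle.mono fun _ h => h s) ?_⟩, ?_, ?_⟩
  · filter_upwards [hη] with γ hγ using hγ.continuous_contRep
  · filter_upwards [ae_ae_eq_contRep hφ hv hη] with s hs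
    exact (hmem s).coeFn_toLp.trans (hs.mono fun _ h => h.symm)
  · rw [← contRep_time0]
    exact (hmem (time0 hT)).coeFn_toLp

end ContRep

section EvalVersion

variable {S X : Type*} [TopologicalSpace S] [CompactSpace S] [MeasurableSpace S]
  [TopologicalSpace X] [MeasurableSpace X] [BorelSpace X] [MeasurableSpace C(S, X)]
  [BorelSpace C(S, X)] {m : Measure X} {η : Measure C(S, X)} {c : ℝ≥0}

/-- The strongly continuous family of operators `s ↦ L · s` from `L²(m)` to `L²(η)` agrees with
the evaluation of curves at `s`, for a.e. `s`. -/
def IsEvalVersion (μ : Measure S) (hc : BoundedCompression η m c)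
    (L : Lp ℝ 2 m →L[ℝ] C(S, Lp ℝ 2 η)) : Prop :=
  ∀ᵐ s ∂μ, ∀ g, L g s = hc.evalOp s g

theorem exists_isEvalVersion {μ : Measure S} [μ.IsOpenPosMeasure]
    [MeasurableSpace.CountablyGenerated X] [SigmaFinite m]
    {A : Submodule ℝ (Lp ℝ 2 m)} (hA : Dense (A : Set (Lp ℝ 2 m))) (hc : BoundedCompression η m c)
    (hF : ∀ f ∈ A, ∃ F : C(S, Lp ℝ 2 η), ∀ᵐ s ∂μ, F s =ᵐ[η] fun γ => f (γ s)) :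
    ∃ L, IsEvalVersion μ hc L := by
  have : Fact ((2 : ℝ≥0∞) ≠ ∞) := ⟨ENNReal.ofNat_ne_top⟩
  refine exists_stronglyContinuous_extension hA hc.evalOp _
    (fun s => (norm_compOp_le _ _).trans (Real.le_coe_toNNReal _)) fun f hf => ?_
  obtain ⟨F, hF⟩ := hF f hf
  refine ⟨F, hF.mono fun s hs => Lp.ext (hs.trans (hc.coeFn_evalOp s f).symm)⟩

end EvalVersion

/-! ### Densities of weighted marginals -/

section Density

variable {X : Type*} [MeasurableSpace X] {m : Measure X}

theorem integrableOn_of_memLp_two {v : X → ℝ} (hv : MemLp v 2 m) {B : Set X} (hB : m B < ∞) :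
    IntegrableOn v B m :=
  have : Fact (m B < ∞) := ⟨hB⟩
  (hv.restrict B).integrable one_le_two

theorem eLpNorm_top_le_of_ae_le {v : X → ℝ} {c : ℝ≥0} (h0 : 0 ≤ᵐ[m] v) (h : ∀ᵐ x ∂m, v x ≤ c) :
    eLpNorm v ∞ m ≤ c := by
  rw [eLpNorm_exponent_top]
  refine eLpNormEssSup_le_of_ae_nnnorm_bound ?_
  filter_upwards [h0, h] with x h0x hx
  rwa [← NNReal.coe_le_coe, coe_nnnorm, Real.norm_of_nonneg h0x]

variable [SigmaFinite m]

/-- The density is written as a product of two Radon–Nikodym derivatives because the jointly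
measurable version in Mathlib requires a finite reference measure. -/
theorem exists_measurable_density {S : Type*} [MeasurableSpace S]
    [MeasurableSpace.CountablyGenerated X] (κ : Kernel S X) [IsFiniteKernel κ]
    (h : ∀ s, κ s ≪ m) :
    ∃ D : S × X → ℝ≥0∞, Measurable D ∧ ∀ s, κ s = m.withDensity fun x => D (s, x) := by
  refine ⟨fun z => m.toFinite.rnDeriv m z.2 * κ.rnDeriv (Kernel.const S m.toFinite) z.1 z.2,
    ((Measure.measurable_rnDeriv _ _).comp measurable_snd).mul (Kernel.measurable_rnDeriv _ _),
    fun s => ?_⟩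
  have hac : κ s ≪ m.toFinite := (h s).trans (absolutelyContinuous_toFinite m)
  have hrn : κ.rnDeriv (Kernel.const S m.toFinite) s =ᵐ[m.toFinite] (κ s).rnDeriv m.toFinite :=
    Kernel.rnDeriv_eq_rnDeriv_measure
  have hmul := withDensity_mul m (Measure.measurable_rnDeriv m.toFinite m)
    (Kernel.measurable_rnDeriv_right κ (Kernel.const S m.toFinite) s)
  rw [Measure.withDensity_rnDeriv_eq _ _ (toFinite_absolutelyContinuous m),
    withDensity_congr_ae hrn,
    Measure.withDensity_rnDeriv_eq _ _ hac] at hmul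
  exact hmul.symm

theorem ae_nonneg_of_setIntegral_nonneg {v : X → ℝ} (hv : MemLp v 2 m)
    (h : ∀ B, MeasurableSet B → m B < ∞ → 0 ≤ ∫ x in B, v x ∂m) : 0 ≤ᵐ[m] v :=
  ae_nonneg_of_forall_setIntegral_nonneg_of_sigmaFinite
    (fun _ _ hB => integrableOn_of_memLp_two hv hB) h

theorem ae_le_of_setIntegral_le {v : X → ℝ} (hv : MemLp v 2 m) {c : ℝ}
    (h : ∀ B, MeasurableSet B → m B < ∞ → ∫ x in B, v x ∂m ≤ c * m.real B) :
    ∀ᵐ x ∂m, v x ≤ c := by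
  have hnonneg : 0 ≤ᵐ[m] fun x => c - v x := by
    refine ae_nonneg_of_forall_setIntegral_nonneg_of_sigmaFinite
      (fun B _ hB => (integrableOn_const hB.ne).sub (integrableOn_of_memLp_two hv hB))
      (fun B hB hmB => ?_)
    rw [integral_sub (integrableOn_const (C := c) hmB.ne) (integrableOn_of_memLp_two hv hmB),
      setIntegral_const, smul_eq_mul, mul_comm]
    exact sub_nonneg.2 (h B hB hmB)
  filter_upwards [hnonneg] with x hx using sub_nonneg.1 hx

theorem eLpNorm_one_le_of_setIntegral_le {v : X → ℝ} (hv : MemLp v 2 m) (h0 : 0 ≤ᵐ[m] v) {K : ℝ}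
    (h : ∀ B, MeasurableSet B → m B < ∞ → ∫ x in B, v x ∂m ≤ K) :
    eLpNorm v 1 m ≤ ENNReal.ofReal K := by
  rw [eLpNorm_one_eq_lintegral_enorm]
  refine lintegral_le_of_forall_fin_meas_le _ fun B hB hmB => ?_
  calc ∫⁻ x in B, ‖v x‖ₑ ∂m = ∫⁻ x in B, ENNReal.ofReal (v x) ∂m :=
        lintegral_congr_ae (ae_restrict_of_ae (h0.mono fun x hx => Real.enorm_eq_ofReal hx))
    _ = ENNReal.ofReal (∫ x in B, v x ∂m) :=
        (ofReal_integral_eq_lintegral_ofReal (integrableOn_of_memLp_two hv hmB.lt_top)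
          (ae_restrict_of_ae h0)).symm
    _ ≤ ENNReal.ofReal K := ENNReal.ofReal_le_ofReal (h B hB hmB.lt_top)

end Density

/-- A weight: an element of `L²` with values in `[0, 1]`. -/
def IsWeight {Ω : Type*} [MeasurableSpace Ω] {η : Measure Ω} (W : Lp ℝ 2 η) : Prop :=
  ∀ᵐ γ ∂η, W γ ∈ Icc (0 : ℝ) 1

section Marginals

variable {S X : Type*} [TopologicalSpace S] [MeasurableSpace S] [TopologicalSpace X]
  [MeasurableSpace X] [MeasurableSpace C(S, X)] {m : Measure X} {η : Measure C(S, X)} {c : ℝ≥0}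

/-- `U` is a jointly Borel density, with respect to `m`, of the marginals of the measure `W η` on
the path space. -/
structure IsMarginalDensity (m : Measure X) (η : Measure C(S, X)) (W : C(S, X) → ℝ)
    (U : S × X → ℝ) : Prop where
  measurable : Measurable U
  integrable : ∀ s, Integrable (fun x => U (s, x)) m
  integral_mul : ∀ s (G : X → ℝ), Measurable G →
    ∫ x, G x * U (s, x) ∂m = ∫ γ, G (γ s) * W γ ∂η

variable [BorelSpace X] [BorelSpace C(S, X)] [IsProbabilityMeasure η] {W : Lp ℝ 2 η}

theorem exists_isMarginalDensity [LocallyCompactSpace S] [SecondCountableTopology S] [BorelSpace S]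
    [SecondCountableTopology X] [SigmaFinite m] (hc : BoundedCompression η m c) (hW : IsWeight W) :
    ∃ U, IsMarginalDensity (S := S) m η W U := by
  set ηW : Measure C(S, X) := η.withDensity fun γ => ENNReal.ofReal (W γ)
  have hWm : Measurable fun γ => ENNReal.ofReal (W γ) :=
    (Lp.stronglyMeasurable W).measurable.ennreal_ofReal
  have : IsFiniteMeasure ηW := isFiniteMeasure_withDensity_ofReal
    ((Lp.memLp W).integrable one_le_two).2
  let κ : Kernel S X :=
    ⟨fun s => ηW.map fun γ => γ s, by
      refine Measure.measurable_of_measurable_coe _ fun B hB => ?_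
      simp_rw [Measure.map_apply (measurable_eval _) hB]
      exact measurable_measure_prodMk_left (measurable_eval_prod hB)⟩
  have : IsFiniteKernel κ := ⟨ηW univ, measure_lt_top _ _, fun s =>
    (Measure.map_apply (measurable_eval s) MeasurableSet.univ).le⟩
  obtain ⟨D, hD, hκD⟩ := exists_measurable_density (m := m) κ fun s =>
    ((withDensity_absolutelyContinuous _ _).map (measurable_eval s)).trans
      (hc.quasiMeasurePreserving s).absolutelyContinuous
  have hDs (s : S) : Measurable fun x => D (s, x) := hD.comp measurable_prodMk_left
  have hDi (s : S) : ∫⁻ x, D (s, x) ∂m ≠ ∞ := by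
    rw [← setLIntegral_univ, ← withDensity_apply _ MeasurableSet.univ, ← hκD]
    exact measure_ne_top _ _
  refine ⟨fun z => (D z).toReal, hD.ennreal_toReal,
    fun s => integrable_toReal_of_lintegral_ne_top (hDs s).aemeasurable (hDi s),
    fun s G hG => ?_⟩
  calc ∫ x, G x * (D (s, x)).toReal ∂m = ∫ x, G x ∂(κ s) := by
        rw [hκD, integral_withDensity_eq_integral_toReal_smul (hDs s) (ae_lt_top (hDs s) (hDi s))]
        simp_rw [smul_eq_mul, mul_comm]
    _ = ∫ γ, G (γ s) ∂ηW :=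
        integral_map (measurable_eval s).aemeasurable hG.aestronglyMeasurable
    _ = ∫ γ, G (γ s) * W γ ∂η := by
        rw [integral_withDensity_eq_integral_toReal_smul hWm (by simp)]
        refine integral_congr_ae ?_
        filter_upwards [hW] with γ hγ
        rw [ENNReal.toReal_ofReal hγ.1, smul_eq_mul, mul_comm]

omit [MeasurableSpace S] in
theorem setIntegral_weight_mem_Icc (hc : BoundedCompression η m c) (hW : IsWeight W) (s : S)
    {B : Set X} (hB : MeasurableSet B) (hmB : m B ≠ ∞) :
    ∫ γ in (fun γ => γ s) ⁻¹' B, W γ ∂η ∈ Icc 0 (min (c * m.real B) 1) := by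
  have hle : ∫ γ in (fun γ => γ s) ⁻¹' B, W γ ∂η ≤ η.real ((fun γ => γ s) ⁻¹' B) := by
    rw [← setIntegral_one_eq_measureReal]
    exact setIntegral_mono_ae ((Lp.memLp W).integrable one_le_two).integrableOn
      (integrable_const 1).integrableOn (hW.mono fun _ h => h.2)
  have hBc : η.real ((fun γ => γ s) ⁻¹' B) ≤ c * m.real B := by
    rw [← map_measureReal_apply (measurable_eval s) hB]
    refine (ENNReal.toReal_mono (ENNReal.mul_ne_top ENNReal.coe_ne_top hmB) (hc s B)).trans_eq ?_
    exact ENNReal.toReal_mul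
  exact ⟨integral_nonneg_of_ae (ae_restrict_of_ae (hW.mono fun _ h => h.1)),
    hle.trans (le_min hBc measureReal_le_one)⟩

end Marginals

section Dual

variable {S X : Type*} [TopologicalSpace S] [MeasurableSpace S] [TopologicalSpace X]
  [MeasurableSpace X] [MeasurableSpace C(S, X)] {m : Measure X} {η : Measure C(S, X)} {c : ℝ≥0}

/-- The function obtained from the weight `W` by the adjoint of `L · s`. When `L · s` is the
evaluation at `s`, it is the density of the marginal at `s` of the measure `W η`. -/
def dualDensity (L : Lp ℝ 2 m →L[ℝ] C(S, Lp ℝ 2 η)) (W : Lp ℝ 2 η) (s : S) : Lp ℝ 2 m :=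
  ContinuousLinearMap.adjoint ((ContinuousMap.evalCLM ℝ s).comp L) W

omit [MeasurableSpace S] in
theorem inner_dualDensity (L : Lp ℝ 2 m →L[ℝ] C(S, Lp ℝ 2 η)) (W : Lp ℝ 2 η)
    (s : S) (g : Lp ℝ 2 m) : ⟪g, dualDensity L W s⟫_ℝ = ⟪L g s, W⟫_ℝ :=
  ContinuousLinearMap.adjoint_inner_right _ _ _

variable [BorelSpace X] [BorelSpace C(S, X)] {μ : Measure S} {hc : BoundedCompression η m c}
  {L : Lp ℝ 2 m →L[ℝ] C(S, Lp ℝ 2 η)} {W : Lp ℝ 2 η}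

namespace IsEvalVersion

theorem ae_eq_dualDensity [SigmaFinite m] (hL : IsEvalVersion μ hc L) {U : S × X → ℝ}
    (hU : IsMarginalDensity m η W U) :
    ∀ᵐ s ∂μ, (fun x => U (s, x)) =ᵐ[m] dualDensity L W s := by
  filter_upwards [hL] with s hs
  refine ae_eq_of_forall_setIntegral_eq_of_sigmaFinite (fun B _ _ => (hU.integrable s).integrableOn)
    (fun B _ hB => integrableOn_of_memLp_two (Lp.memLp _) hB) fun B hB hmB => ?_
  rw [← L2.inner_indicatorConstLp_one hB hmB.ne, inner_dualDensity, hs,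
    hc.inner_evalOp_indicator s hB hmB.ne, ← integral_indicator hB,
    ← integral_indicator (measurable_eval s hB)]
  convert hU.integral_mul s (B.indicator 1) (measurable_one.indicator hB) using 3 with x γ
  · by_cases hx : x ∈ B <;> simp [hx]
  · by_cases hγ : γ s ∈ B <;> simp [hγ]

variable [IsProbabilityMeasure η] [μ.IsOpenPosMeasure]

theorem setIntegral_dualDensity_mem_Icc (hL : IsEvalVersion μ hc L) (hW : IsWeight W) (s : S)
    {B : Set X} (hB : MeasurableSet B) (hmB : m B ≠ ∞) :
    ∫ x in B, dualDensity L W s x ∂m ∈ Icc 0 (min (c * m.real B) 1) := by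
  rw [← L2.inner_indicatorConstLp_one hB hmB, inner_dualDensity]
  refine forall_mem_of_ae_mem μ (F := fun s => ⟪L _ s, W⟫_ℝ) (by fun_prop) isClosed_Icc ?_ s
  filter_upwards [hL] with r hr
  rw [hr, hc.inner_evalOp_indicator r hB hmB]
  exact setIntegral_weight_mem_Icc hc hW r hB hmB

variable [SigmaFinite m]

theorem dualDensity_nonneg (hL : IsEvalVersion μ hc L) (hW : IsWeight W) (s : S) :
    0 ≤ᵐ[m] dualDensity L W s :=
  ae_nonneg_of_setIntegral_nonneg (Lp.memLp _) fun _ hB hmB =>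
    (hL.setIntegral_dualDensity_mem_Icc hW s hB hmB.ne).1

theorem eLpNorm_one_dualDensity_le (hL : IsEvalVersion μ hc L) (hW : IsWeight W) (s : S) :
    eLpNorm (dualDensity L W s) 1 m ≤ 1 :=
  (eLpNorm_one_le_of_setIntegral_le (Lp.memLp _) (hL.dualDensity_nonneg hW s) fun _ hB hmB =>
    (hL.setIntegral_dualDensity_mem_Icc hW s hB hmB.ne).2.trans (min_le_right _ _)).trans
      ENNReal.ofReal_one.le

theorem eLpNorm_top_dualDensity_le (hL : IsEvalVersion μ hc L) (hW : IsWeight W) (s : S) :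
    eLpNorm (dualDensity L W s) ∞ m ≤ c :=
  eLpNorm_top_le_of_ae_le (hL.dualDensity_nonneg hW s) <|
    ae_le_of_setIntegral_le (Lp.memLp _) fun _ hB hmB =>
      (hL.setIntegral_dualDensity_mem_Icc hW s hB hmB.ne).2.trans (min_le_left _ _)

end IsEvalVersion

end Dual

/-! ### The continuity equation -/

section WeakField

variable {X : Type*} [MeasurableSpace X] {m : Measure X}

/-- A time-dependent Borel vector field on `X`, known only through its action on the test functions
`f ∈ A`: `fn f` is a Borel representative of `f`, and `dfn f (t, x)` stands for the derivative of
`f` at `x` in the direction of the field at time `t`. -/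
structure WeakField (A : Submodule ℝ (Lp ℝ 2 m)) where
  /-- representative of `f` -/
  fn : A → X → ℝ
  /-- derivative of `f` along the field -/
  dfn : A → ℝ × X → ℝ
  measurable_fn : ∀ f, Measurable (fn f)
  fn_ae : ∀ f : A, fn f =ᵐ[m] (f : Lp ℝ 2 m)
  measurable_dfn : ∀ f, Measurable (dfn f)

variable {A : Submodule ℝ (Lp ℝ 2 m)}

/-- `u` is a weak solution in `(0, T) × X` of the continuity equation of the field `V`, with
initial condition `u₀`. -/
def WeakField.SolvesContinuityEq (V : WeakField A) (T : ℝ) (u : ℝ → X → ℝ) (u₀ : X → ℝ) : Prop :=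
  ∀ (f : A) (ψ : ℝ → ℝ), ContDiff ℝ 1 ψ → ψ T = 0 →
    ∫ t in Ioo 0 T, ∫ x, (-(deriv ψ t) * V.fn f x - ψ t * V.dfn f (t, x)) * u t x ∂m
      = ψ 0 * ∫ x, V.fn f x * u₀ x ∂m

/-- For every initial datum in `L¹ ∩ L^∞`, the continuity equation of the field `V` has at most one
solution in the class `𝓛₊`. -/
def WeakField.UniqueInLPlus (V : WeakField A) (T : ℝ) : Prop :=
  ∀ u₀ : X → ℝ, MemLp u₀ 1 m → MemLp u₀ ∞ m →
    ∀ u v : ℝ → X → ℝ, MemLPlus m A T u → MemLPlus m A T v →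
      V.SolvesContinuityEq T u u₀ → V.SolvesContinuityEq T v u₀ → ∀ t ∈ Icc 0 T, u t =ᵐ[m] v t

/-- The measure `η` is concentrated on curves `γ` solving the ODE `γ' = V (t, γ)`, tested against
the functions `f ∈ A`. -/
def WeakField.ConcentratedOnSolutions [TopologicalSpace X] {T : ℝ} (V : WeakField A) (hT : 0 < T)
    [MeasurableSpace C(Icc (0 : ℝ) T, X)] (η : Measure C(Icc (0 : ℝ) T, X)) : Prop :=
  ∀ f, ∀ᵐ γ ∂η, HasVelocityAlong hT (V.fn f) (V.dfn f) γ

variable (m) in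
/-- `v` is dominated by a function of class `L¹_t(L¹_x + L^∞_x)` on `(0, T) × X`. -/
def DominatedInL1L1Linf (T : ℝ) (v : ℝ × X → ℝ) : Prop :=
  ∃ g, MemL1L1Linf T m g ∧ ∀ᵐ t ∂(volume.restrict (Ioo 0 T)), ∀ᵐ x ∂m, |v (t, x)| ≤ g (t, x)

theorem ae_abs_le_eLpNorm_top {v : X → ℝ} (hv : MemLp v ∞ m) :
    ∀ᵐ x ∂m, |v x| ≤ (eLpNorm v ∞ m).toReal := by
  have htop := hv.2.ne
  rw [eLpNorm_exponent_top] at htop ⊢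
  filter_upwards [enorm_ae_le_eLpNormEssSup v m] with x hx
  rw [← Real.norm_eq_abs, ← toReal_enorm]
  exact ENNReal.toReal_mono htop hx

theorem WeakField.ae_abs_fn_le (V : WeakField A) {f : A} (hf : MemLp (f : Lp ℝ 2 m) ∞ m) :
    ∀ᵐ x ∂m, |V.fn f x| ≤ (eLpNorm (f : Lp ℝ 2 m) ∞ m).toReal := by
  filter_upwards [V.fn_ae f, ae_abs_le_eLpNorm_top hf] with x hx hle
  rwa [hx]

end WeakField

section PathIntegrals

variable {X : Type*} [TopologicalSpace X] [MeasurableSpace X] [BorelSpace X] {m : Measure X}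

namespace BoundedCompression

variable {S : Type*} [TopologicalSpace S] [MeasurableSpace C(S, X)] [BorelSpace C(S, X)]
  {η : Measure C(S, X)} {c : ℝ≥0}

theorem lintegral_eval_le (hc : BoundedCompression η m c) (s : S) {G : X → ℝ≥0∞}
    (hG : Measurable G) : ∫⁻ γ, G (γ s) ∂η ≤ c * ∫⁻ x, G x ∂m := by
  rw [← lintegral_map hG (measurable_eval s), ← smul_eq_mul, ← lintegral_smul_measure]
  exact lintegral_mono' (hc s) le_rfl

theorem lintegral_enorm_eval_le [IsProbabilityMeasure η] (hc : BoundedCompression η m c) (s : S)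
    {w w₁ w₂ : X → ℝ} (hw₁ : Measurable w₁) (h : ∀ᵐ x ∂m, |w x| ≤ w₁ x + w₂ x) :
    ∫⁻ γ, ‖w (γ s)‖ₑ ∂η ≤ c * eLpNorm w₁ 1 m + eLpNorm w₂ ∞ m := by
  have hle : ∀ᵐ x ∂m, ‖w x‖ₑ ≤ ‖w₁ x‖ₑ + eLpNorm w₂ ∞ m := by
    filter_upwards [h, enorm_ae_le_eLpNormEssSup w₂ m] with x hx hx₂
    rw [eLpNorm_exponent_top]
    calc ‖w x‖ₑ ≤ ‖w₁ x + w₂ x‖ₑ := enorm_le_iff_norm_le.2 (hx.trans (le_abs_self _))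
      _ ≤ ‖w₁ x‖ₑ + ‖w₂ x‖ₑ := enorm_add_le _ _
      _ ≤ _ := by gcongr
  calc ∫⁻ γ, ‖w (γ s)‖ₑ ∂η ≤ ∫⁻ γ, (‖w₁ (γ s)‖ₑ + eLpNorm w₂ ∞ m) ∂η :=
        lintegral_mono_ae (hc.ae_eval hle s)
    _ = ∫⁻ γ, ‖w₁ (γ s)‖ₑ ∂η + eLpNorm w₂ ∞ m := by
        rw [lintegral_add_right _ measurable_const, lintegral_const, measure_univ, mul_one]
    _ ≤ c * eLpNorm w₁ 1 m + eLpNorm w₂ ∞ m := by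
        rw [eLpNorm_one_eq_lintegral_enorm]
        gcongr
        exact hc.lintegral_eval_le s hw₁.enorm

end BoundedCompression

variable [PolishSpace X] {T : ℝ} [MeasurableSpace C(Icc (0 : ℝ) T, X)]
  [BorelSpace C(Icc (0 : ℝ) T, X)] {η : Measure C(Icc (0 : ℝ) T, X)} [IsProbabilityMeasure η]
  {c : ℝ≥0} {φ : X → ℝ} {v : ℝ × X → ℝ}

theorem integrable_comp_iccExtend_of_bounded (hT : 0 < T) (hc : BoundedCompression η m c)
    (hφ : Measurable φ) {M : ℝ} (hM : ∀ᵐ x ∂m, |φ x| ≤ M) :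
    Integrable (fun z : ℝ × C(Icc (0 : ℝ) T, X) => φ (IccExtend hT.le z.2 z.1))
      ((volume.restrict (Ioo 0 T)).prod η) := by
  have hmeas : Measurable fun z : ℝ × C(Icc (0 : ℝ) T, X) => φ (IccExtend hT.le z.2 z.1) :=
    hφ.comp (measurable_iccExtend_prod hT)
  refine .of_bound hmeas.aestronglyMeasurable M ?_
  rw [Measure.ae_prod_iff_ae_ae (measurableSet_le hmeas.norm measurable_const)]
  exact ae_of_all _ fun t => hc.ae_eval hM (projIcc 0 T hT.le t)

theorem integrable_comp_iccExtend_of_dominated [SFinite m] (hT : 0 < T)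
    (hc : BoundedCompression η m c) (hv : Measurable v) (hd : DominatedInL1L1Linf m T v) :
    Integrable (fun z : ℝ × C(Icc (0 : ℝ) T, X) => v (z.1, IccExtend hT.le z.2 z.1))
      ((volume.restrict (Ioo 0 T)).prod η) := by
  obtain ⟨g, ⟨g₁, g₂, hg₁, -, hg, hi₁, hi₂⟩, hvg⟩ := hd
  have hmeas := measurable_comp_iccExtend (X := X) hT hv
  refine ⟨hmeas.aestronglyMeasurable, ?_⟩
  have hle : ∀ᵐ t ∂(volume.restrict (Ioo 0 T)),
      ∫⁻ γ : C(Icc (0 : ℝ) T, X), ‖v (t, IccExtend hT.le γ t)‖ₑ ∂η ≤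
        c * eLpNorm (fun x => g₁ (t, x)) 1 m + eLpNorm (fun x => g₂ (t, x)) ∞ m := by
    filter_upwards [hvg, hg] with t hvt hgt
    refine hc.lintegral_enorm_eval_le (projIcc 0 T hT.le t) (w := fun x => v (t, x))
      (hg₁.comp measurable_prodMk_left) ?_
    filter_upwards [hvt, hgt] with x hx hgx
    rwa [← hgx]
  have hm : Measurable fun t => eLpNorm (fun x => g₁ (t, x)) 1 m := by
    simp_rw [eLpNorm_one_eq_lintegral_enorm]
    exact hg₁.enorm.lintegral_prod_right'
  rw [HasFiniteIntegral, lintegral_prod _ hmeas.enorm.aemeasurable]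
  refine (lintegral_mono_ae hle).trans_lt ?_
  rw [lintegral_add_left (hm.const_mul _), lintegral_const_mul' _ _ ENNReal.coe_ne_top]
  exact ENNReal.add_lt_top.2 ⟨ENNReal.mul_lt_top ENNReal.coe_lt_top hi₁, hi₂⟩

end PathIntegrals

section Weights

variable {Ω : Type*} [MeasurableSpace Ω] {η : Measure Ω}

theorem integrable_continuous_fst_mul {a b : ℝ} {F : ℝ × Ω → ℝ}
    (hF : Integrable F ((volume.restrict (Ioo a b)).prod η)) {ψ : ℝ → ℝ} (hψ : Continuous ψ) :
    Integrable (fun z => ψ z.1 * F z) ((volume.restrict (Ioo a b)).prod η) := by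
  obtain ⟨M, hM⟩ := isCompact_Icc.exists_bound_of_continuousOn (s := Icc a b) hψ.continuousOn
  refine hF.bdd_mul (c := M) (hψ.measurable.comp measurable_fst).aestronglyMeasurable
    (Measure.quasiMeasurePreserving_fst.ae (p := fun t => ‖ψ t‖ ≤ M) ?_)
  filter_upwards [self_mem_ae_restrict measurableSet_Ioo] with t ht
    using hM t (Ioo_subset_Icc_self ht)

theorem IsWeight.integrable_mul {S : Type*} [MeasurableSpace S] {μ : Measure S} [SFinite μ]
    {W : Lp ℝ 2 η} (hW : IsWeight W) {F : S × Ω → ℝ} (hF : Integrable F (μ.prod η)) :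
    Integrable (fun z => F z * W z.2) (μ.prod η) := by
  refine hF.mul_bdd (c := 1)
    ((Lp.stronglyMeasurable W).comp_measurable measurable_snd).aestronglyMeasurable
    (Measure.quasiMeasurePreserving_snd.ae (p := fun γ => ‖W γ‖ ≤ 1) ?_)
  filter_upwards [hW] with γ hγ
  rw [Real.norm_of_nonneg hγ.1]
  exact hγ.2

variable {X : Type*} [TopologicalSpace X] {T : ℝ} {hT : 0 < T}
  [MeasurableSpace C(Icc (0 : ℝ) T, X)] {η : Measure C(Icc (0 : ℝ) T, X)} [SFinite η]
  {φ : X → ℝ} {v : ℝ × X → ℝ}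

theorem integral_mul_weight_eq_initial
    (hφ : Integrable (fun z : ℝ × C(Icc (0 : ℝ) T, X) => φ (IccExtend hT.le z.2 z.1))
      ((volume.restrict (Ioo 0 T)).prod η))
    (hv : Integrable (fun z : ℝ × C(Icc (0 : ℝ) T, X) => v (z.1, IccExtend hT.le z.2 z.1))
      ((volume.restrict (Ioo 0 T)).prod η))
    (hη : ∀ᵐ γ ∂η, HasVelocityAlong hT φ v γ) {W : Lp ℝ 2 η} (hW : IsWeight W) {ψ : ℝ → ℝ}
    (hψ : ContDiff ℝ 1 ψ) (hψT : ψ T = 0) :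
    ∫ t in Ioo 0 T, ∫ γ : C(Icc (0 : ℝ) T, X),
        (-(deriv ψ t) * φ (IccExtend hT.le γ t) - ψ t * v (t, IccExtend hT.le γ t)) * W γ ∂η
      = ψ 0 * ∫ γ, initialValueAlong hT φ v γ * W γ ∂η := by
  have hint := hW.integrable_mul
    ((integrable_continuous_fst_mul hφ (hψ.continuous_deriv le_rfl).neg).sub
      (integrable_continuous_fst_mul hv hψ.continuous))
  rw [integral_integral_swap hint, ← integral_const_mul]
  refine integral_congr_ae ?_
  filter_upwards [hη] with γ hγ
  have hparts := integral_deriv_mul_add_of_ae_eq hT.le hγ.2.1 hγ.ae_eq_primitive hψ hψT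
  have hγψ : ∫ t in Ioo 0 T, (-(deriv ψ t) * φ (IccExtend hT.le γ t) -
      ψ t * v (t, IccExtend hT.le γ t)) = ψ 0 * initialValueAlong hT φ v γ := by
    rw [← neg_neg (ψ 0 * _), ← hparts, ← integral_neg]
    simp only [neg_add, neg_mul, sub_eq_add_neg]
  rw [integral_mul_const, hγψ, mul_assoc]

end Weights

theorem exists_forall_ae_eq_of_ae_ae_eq {S X Y : Type*} [MeasurableSpace S] [MeasurableSpace X]
    {μ : Measure S} {m : Measure X} {v w : S → X → Y} (h : ∀ᵐ s ∂μ, v s =ᵐ[m] w s) :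
    ∃ u : S → X → Y, (∀ s, u s =ᵐ[m] w s) ∧ ∀ᵐ s ∂μ, u s = v s := by
  classical
  refine ⟨fun s => if v s =ᵐ[m] w s then v s else w s, fun s => ?_, h.mono fun s hs => if_pos hs⟩
  by_cases hs : v s =ᵐ[m] w s
  · simpa only [if_pos hs] using hs
  · simp only [if_neg hs, EventuallyEq.refl]

/-- Two measures `W₁ η` and `W₂ η` with the same marginal at the parameter `s₀` have the same
marginals at every parameter; the marginals are encoded by `dualDensity L`. -/
def MarginalsDetermined {S X : Type*} [TopologicalSpace S] [TopologicalSpace X] [MeasurableSpace X]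
    [MeasurableSpace C(S, X)] {m : Measure X} {η : Measure C(S, X)}
    (L : Lp ℝ 2 m →L[ℝ] C(S, Lp ℝ 2 η)) (s₀ : S) : Prop :=
  ∀ W₁ W₂, IsWeight W₁ → IsWeight W₂ → dualDensity L W₁ s₀ = dualDensity L W₂ s₀ →
    ∀ s, dualDensity L W₁ s = dualDensity L W₂ s

section Solutions

variable {X : Type*} [TopologicalSpace X] [MeasurableSpace X] [BorelSpace X]
  {m : Measure X} [SigmaFinite m] {A : Submodule ℝ (Lp ℝ 2 m)} {V : WeakField A} {T : ℝ}
  {hT : 0 < T} [MeasurableSpace C(Icc (0 : ℝ) T, X)] [BorelSpace C(Icc (0 : ℝ) T, X)]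
  {η : Measure C(Icc (0 : ℝ) T, X)} [IsProbabilityMeasure η] {c : ℝ≥0}
  {hc : BoundedCompression η m c} {L : Lp ℝ 2 m →L[ℝ] C(Icc (0 : ℝ) T, Lp ℝ 2 η)}
  {W : Lp ℝ 2 η} {U : Icc (0 : ℝ) T × X → ℝ} {u : ℝ → X → ℝ}

theorem IsEvalVersion.memLPlus (hT : 0 < T) (hL : IsEvalVersion volume hc L) (hW : IsWeight W)
    (hU : Measurable U) (hu : ∀ t, u t =ᵐ[m] dualDensity L W (projIcc 0 T hT.le t))
    (huU : ∀ᵐ t ∂(volume.restrict (Ioo 0 T)), u t = fun x => U (projIcc 0 T hT.le t, x)) :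
    MemLPlus m A T u := by
  have := isOpenPosMeasure_Icc hT
  have hu₁ (t : ℝ) : eLpNorm (u t) 1 m ≤ 1 :=
    (eLpNorm_congr_ae (hu t)).trans_le (hL.eLpNorm_one_dualDensity_le hW _)
  have hu_top (t : ℝ) : eLpNorm (u t) ∞ m ≤ c :=
    (eLpNorm_congr_ae (hu t)).trans_le (hL.eLpNorm_top_dualDensity_le hW _)
  have hum (t : ℝ) : AEStronglyMeasurable (u t) m := (Lp.memLp _).1.congr (hu t).symm
  refine ⟨⟨fun z => U (projIcc 0 T hT.le z.1, z.2), ?_, ?_⟩,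
    fun t _ => ⟨hum t, (hu₁ t).trans_lt ENNReal.one_lt_top⟩,
    fun t _ => ⟨hum t, (hu_top t).trans_lt ENNReal.coe_lt_top⟩,
    ⟨max 1 c, ae_of_all _ fun t => ⟨(hu₁ t).trans (by simp), (hu_top t).trans (by simp)⟩⟩,
    fun t _ => (hL.dualDensity_nonneg hW _).trans (hu t).symm.le, fun f _ => ?_⟩
  · exact (hU.comp ((continuous_projIcc.measurable.comp measurable_fst).prodMk
      measurable_snd)).stronglyMeasurable
  · filter_upwards [Measure.quasiMeasurePreserving_fst.ae huU] with z hz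
    exact congrFun hz z.2
  · have hcont : Continuous fun t => ⟪L f (projIcc 0 T hT.le t), W⟫_ℝ :=
      ((L f).continuous.comp continuous_projIcc).inner continuous_const
    refine hcont.continuousOn.congr fun t _ => ?_
    simp only
    rw [← inner_dualDensity, L2.inner_def]
    refine integral_congr_ae ?_
    filter_upwards [hu t] with x hx
    rw [hx, RCLike.inner_apply, conj_trivial, mul_comm]

variable [PolishSpace X]

omit [SigmaFinite m] in
theorem WeakField.exists_continuousMap_eval (hη : V.ConcentratedOnSolutions hT η)
    (hc : BoundedCompression η m c) {f : A} (hf : MemLp (f : Lp ℝ 2 m) ∞ m) :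
    ∃ F : C(Icc (0 : ℝ) T, Lp ℝ 2 η), (∀ᵐ s, F s =ᵐ[η] fun γ => (f : Lp ℝ 2 m) (γ s)) ∧
      F (time0 hT) =ᵐ[η] initialValueAlong hT (V.fn f) (V.dfn f) := by
  obtain ⟨F, hF, hF₀⟩ := NoSplitting.exists_continuousMap_eval (V.measurable_fn f)
    (V.measurable_dfn f) (hη f) hc (V.ae_abs_fn_le hf)
  exact ⟨F, hF.mono fun s hs => hs.trans (hc.ae_eval (V.fn_ae f) s), hF₀⟩

theorem WeakField.exists_isEvalVersion (hA : Dense (A : Set (Lp ℝ 2 m)))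
    (hAb : ∀ f ∈ A, MemLp f ∞ m) (hη : V.ConcentratedOnSolutions hT η)
    (hc : BoundedCompression η m c) : ∃ L, IsEvalVersion volume hc L :=
  have := isOpenPosMeasure_Icc hT
  NoSplitting.exists_isEvalVersion hA hc fun f hf =>
    (exists_continuousMap_eval hη hc (f := ⟨f, hf⟩) (hAb f hf)).imp fun _ hF => hF.1

namespace IsEvalVersion

omit [SigmaFinite m] in
theorem ae_eq_initialValueAlong (hL : IsEvalVersion volume hc L)
    (hη : V.ConcentratedOnSolutions hT η) {f : A} (hf : MemLp (f : Lp ℝ 2 m) ∞ m) :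
    L f (time0 hT) =ᵐ[η] initialValueAlong hT (V.fn f) (V.dfn f) := by
  have := isOpenPosMeasure_Icc hT
  obtain ⟨F, hF, hF₀⟩ := V.exists_continuousMap_eval hη hc hf
  have hLF : L f = F := by
    refine continuousMap_eq_of_ae_eq volume ?_
    filter_upwards [hL, hF] with s hs hFs
    exact (hs _).trans (Lp.ext ((hc.coeFn_evalOp s _).trans hFs.symm))
  rwa [hLF]

omit [SigmaFinite m] in
theorem integral_mul_dualDensity_time0 (hL : IsEvalVersion volume hc L)
    (hη : V.ConcentratedOnSolutions hT η) {f : A} (hf : MemLp (f : Lp ℝ 2 m) ∞ m) :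
    ∫ x, V.fn f x * dualDensity L W (time0 hT) x ∂m =
      ∫ γ, initialValueAlong hT (V.fn f) (V.dfn f) γ * W γ ∂η := by
  calc ∫ x, V.fn f x * dualDensity L W (time0 hT) x ∂m
      = ⟪(f : Lp ℝ 2 m), dualDensity L W (time0 hT)⟫_ℝ := by
        rw [L2.inner_def]
        refine integral_congr_ae ?_
        filter_upwards [V.fn_ae f] with x hx
        rw [hx, RCLike.inner_apply, conj_trivial, mul_comm]
    _ = ⟪L f (time0 hT), W⟫_ℝ := inner_dualDensity _ _ _ _
    _ = ∫ γ, initialValueAlong hT (V.fn f) (V.dfn f) γ * W γ ∂η := by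
        rw [L2.inner_def]
        refine integral_congr_ae ?_
        filter_upwards [hL.ae_eq_initialValueAlong hη hf] with γ hγ
        rw [hγ, RCLike.inner_apply, conj_trivial, mul_comm]

theorem solvesContinuityEq (hL : IsEvalVersion volume hc L) (hAb : ∀ f ∈ A, MemLp f ∞ m)
    (hV : ∀ f, DominatedInL1L1Linf m T (V.dfn f)) (hη : V.ConcentratedOnSolutions hT η)
    (hW : IsWeight W) (hU : IsMarginalDensity m η W U)
    (huU : ∀ᵐ t ∂(volume.restrict (Ioo 0 T)), u t = fun x => U (projIcc 0 T hT.le t, x)) :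
    V.SolvesContinuityEq T u (dualDensity L W (time0 hT)) := by
  intro f ψ hψ hψT
  have hf := hAb f f.2
  rw [hL.integral_mul_dualDensity_time0 hη hf, ← integral_mul_weight_eq_initial
    (integrable_comp_iccExtend_of_bounded hT hc (V.measurable_fn f) (V.ae_abs_fn_le hf))
    (integrable_comp_iccExtend_of_dominated hT hc (V.measurable_dfn f) (hV f)) (hη f) hW hψ hψT]
  refine integral_congr_ae ?_
  filter_upwards [huU] with t ht
  rw [ht]
  exact hU.integral_mul (projIcc 0 T hT.le t)
    (fun x => -(deriv ψ t) * V.fn f x - ψ t * V.dfn f (t, x))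
    (((V.measurable_fn f).const_mul _).sub
      (((V.measurable_dfn f).comp measurable_prodMk_left).const_mul _))

end IsEvalVersion

theorem IsEvalVersion.exists_solution (hL : IsEvalVersion volume hc L)
    (hAb : ∀ f ∈ A, MemLp f ∞ m) (hV : ∀ f, DominatedInL1L1Linf m T (V.dfn f))
    (hη : V.ConcentratedOnSolutions hT η) (hW : IsWeight W) :
    ∃ u : ℝ → X → ℝ, MemLPlus m A T u ∧
      V.SolvesContinuityEq T u (dualDensity L W (time0 hT)) ∧
      ∀ s : Icc (0 : ℝ) T, u s =ᵐ[m] dualDensity L W s := by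
  obtain ⟨U, hU⟩ := exists_isMarginalDensity hc hW
  obtain ⟨u, hu, huU⟩ := exists_forall_ae_eq_of_ae_ae_eq
    ((ae_Icc_iff hT.le).1 (hL.ae_eq_dualDensity hU))
  refine ⟨u, hL.memLPlus hT hW hU.measurable hu huU, hL.solvesContinuityEq hAb hV hη hW hU huU,
    fun s => ?_⟩
  simpa only [projIcc_val] using hu s

theorem IsEvalVersion.marginalsDetermined (hL : IsEvalVersion volume hc L)
    (hAb : ∀ f ∈ A, MemLp f ∞ m) (hV : ∀ f, DominatedInL1L1Linf m T (V.dfn f))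
    (hη : V.ConcentratedOnSolutions hT η) (hunique : V.UniqueInLPlus T) :
    MarginalsDetermined L (time0 hT) := by
  intro W₁ W₂ hW₁ hW₂ h₀ s
  have := isOpenPosMeasure_Icc hT
  obtain ⟨u₁, hu₁, hus₁, hud₁⟩ := hL.exists_solution hAb hV hη hW₁
  obtain ⟨u₂, hu₂, hus₂, hud₂⟩ := hL.exists_solution hAb hV hη hW₂
  rw [← h₀] at hus₂
  have hu := hunique _
    ⟨(Lp.memLp _).1, (hL.eLpNorm_one_dualDensity_le hW₁ _).trans_lt ENNReal.one_lt_top⟩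
    ⟨(Lp.memLp _).1, (hL.eLpNorm_top_dualDensity_le hW₁ _).trans_lt ENNReal.coe_lt_top⟩
    u₁ u₂ hu₁ hu₂ hus₁ hus₂ s s.2
  exact Lp.ext ((hud₁ s).symm.trans (hu.trans (hud₂ s)))

end Solutions

/-! ### Strong continuity at every time -/

theorem ae_mem_of_tendsto_Lp {Ω Z E E' : Type*} [MeasurableSpace Ω] {η : Measure Ω}
    [TopologicalSpace Z] [NormedAddCommGroup E] [NormedAddCommGroup E'] {p : ℝ≥0∞} [Fact (1 ≤ p)]
    {z : ℕ → Ω → Z} {z₀ : Ω → Z} {F : ℕ → Lp E p η} {F₀ : Lp E p η} {G : ℕ → Lp E' p η}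
    {G₀ : Lp E' p η} (hz : ∀ γ, Tendsto (fun n => z n γ) atTop (𝓝 (z₀ γ)))
    (hF : Tendsto F atTop (𝓝 F₀)) (hG : Tendsto G atTop (𝓝 G₀)) {R : Set (Z × E × E')}
    (hR : IsClosed R) (h : ∀ n, ∀ᵐ γ ∂η, (z n γ, F n γ, G n γ) ∈ R) :
    ∀ᵐ γ ∂η, (z₀ γ, F₀ γ, G₀ γ) ∈ R := by
  obtain ⟨k, hk, hFk⟩ := (tendstoInMeasure_of_tendsto_Lp hF).exists_seq_tendsto_ae
  obtain ⟨l, hl, hGl⟩ :=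
    (tendstoInMeasure_of_tendsto_Lp (hG.comp hk.tendsto_atTop)).exists_seq_tendsto_ae
  filter_upwards [hFk, hGl, ae_all_iff.2 h] with γ hFγ hGγ hγ
  have hzγ := (hz γ).comp (hk.comp hl).tendsto_atTop
  exact hR.mem_of_tendsto (hzγ.prodMk_nhds ((hFγ.comp hl.tendsto_atTop).prodMk_nhds hGγ))
    (Eventually.of_forall fun i => hγ (k (l i)))

section Weighted

variable {X : Type*} [MeasurableSpace X] {m : Measure X}

theorem exists_pos_le_one_memLp_two (m : Measure X) [SigmaFinite m] :
    ∃ h : X → ℝ, Measurable h ∧ (∀ x, 0 < h x) ∧ (∀ x, h x ≤ 1) ∧ MemLp h 2 m := by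
  obtain ⟨g, hg0, hgm, hgi⟩ := exists_pos_lintegral_lt_of_sigmaFinite m one_ne_zero
  have hm : Measurable fun x => min (g x : ℝ) 1 := hgm.coe_nnreal_real.min measurable_const
  have h0 (x : X) : 0 < min (g x : ℝ) 1 := lt_min (hg0 x) one_pos
  have hg : Integrable (fun x => (g x : ℝ)) m :=
    ⟨hgm.coe_nnreal_real.aestronglyMeasurable, by
      simpa [HasFiniteIntegral] using hgi.trans ENNReal.one_lt_top⟩
  refine ⟨_, hm, h0, fun x => min_le_right _ _,
    (memLp_two_iff_integrable_sq hm.aestronglyMeasurable).2 (hg.mono'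
      (hm.pow_const 2).aestronglyMeasurable (ae_of_all _ fun x => ?_))⟩
  rw [Real.norm_of_nonneg (sq_nonneg _), sq]
  exact (mul_le_of_le_one_right (h0 x).le (min_le_right _ _)).trans (min_le_left _ _)

theorem eLpNorm_two_withDensity_sq {h : X → ℝ} (hm : Measurable h) (f : X → ℝ) :
    eLpNorm f 2 (m.withDensity fun x => ENNReal.ofReal (h x ^ 2)) =
      eLpNorm (fun x => f x * h x) 2 m := by
  have hd : Measurable fun x => ENNReal.ofReal (h x ^ 2) := (hm.pow_const 2).ennreal_ofReal
  rw [eLpNorm_eq_lintegral_rpow_enorm_toReal two_ne_zero ENNReal.ofNat_ne_top,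
    eLpNorm_eq_lintegral_rpow_enorm_toReal two_ne_zero ENNReal.ofNat_ne_top,
    lintegral_withDensity_eq_lintegral_mul_non_measurable _ hd (by simp)]
  congr 1
  refine lintegral_congr fun x => ?_
  rw [Pi.mul_apply, enorm_mul, ENNReal.mul_rpow_of_nonneg _ _ (by simp), mul_comm]
  congr 1
  rw [Real.enorm_eq_ofReal_abs, ENNReal.toReal_ofNat, ENNReal.rpow_two,
    ← ENNReal.ofReal_pow (abs_nonneg _), sq_abs]

theorem isFiniteMeasure_withDensity_sq {h : X → ℝ} (hm : Measurable h) (h2 : MemLp h 2 m) :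
    IsFiniteMeasure (m.withDensity fun x => ENNReal.ofReal (h x ^ 2)) :=
  isFiniteMeasure_withDensity_ofReal
    ((memLp_two_iff_integrable_sq hm.aestronglyMeasurable).1 h2).2

theorem dense_continuous_mul [TopologicalSpace X] [PolishSpace X] [BorelSpace X] {h : X → ℝ}
    (hm : Measurable h) (h0 : ∀ x, 0 < h x) (h2 : MemLp h 2 m) :
    Dense {G : Lp ℝ 2 m | ∃ φ : X → ℝ, Continuous φ ∧ G =ᵐ[m] fun x => φ x * h x} := by
  let _ := TopologicalSpace.upgradeIsCompletelyMetrizable X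
  have := isFiniteMeasure_withDensity_sq hm h2
  intro g
  rw [EMetric.mem_closure_iff]
  intro ε hε
  obtain ⟨δ, hδ, hδε⟩ := exists_between hε
  have hg : (fun x => g x / h x * h x) = g := funext fun x => div_mul_cancel₀ _ (h0 x).ne'
  have hgh : MemLp (fun x => g x / h x) 2 (m.withDensity fun x => ENNReal.ofReal (h x ^ 2)) := by
    refine ⟨((Lp.stronglyMeasurable g).measurable.div hm).aestronglyMeasurable, ?_⟩
    rw [eLpNorm_two_withDensity_sq hm, hg]
    exact (Lp.memLp g).2
  obtain ⟨φ, hφ, hφν⟩ := hgh.exists_boundedContinuous_eLpNorm_sub_le ENNReal.ofNat_ne_top hδ.ne'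
  have hφh : MemLp (fun x => φ x * h x) 2 m :=
    ⟨(φ.continuous.measurable.mul hm).aestronglyMeasurable, by
      rw [← eLpNorm_two_withDensity_sq hm]; exact hφν.2⟩
  refine ⟨hφh.toLp _, ⟨φ, φ.continuous, hφh.coeFn_toLp⟩, lt_of_le_of_lt ?_ hδε⟩
  rw [Lp.edist_def]
  refine le_trans (eLpNorm_congr_ae ?_).le ((eLpNorm_two_withDensity_sq hm _).symm.le.trans hφ)
  filter_upwards [hφh.coeFn_toLp] with x hx
  rw [Pi.sub_apply, hx, Pi.sub_apply, sub_mul, div_mul_cancel₀ _ (h0 x).ne']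

end Weighted

section EveryTime

variable {S X : Type*} [TopologicalSpace S] [MeasurableSpace S] [TopologicalSpace X]
  [MeasurableSpace X] [BorelSpace X] [MeasurableSpace C(S, X)] [BorelSpace C(S, X)]
  {m : Measure X} {η : Measure C(S, X)} {c : ℝ≥0} {hc : BoundedCompression η m c}
  {μ : Measure S} [μ.IsOpenPosMeasure] {L : Lp ℝ 2 m →L[ℝ] C(S, Lp ℝ 2 η)}

namespace IsEvalVersion

theorem eq_zero_of_dualDensity_eq_zero [Nonempty S] [SigmaFinite m] (hL : IsEvalVersion μ hc L)
    {W : Lp ℝ 2 η} (hW : 0 ≤ᵐ[η] W) (hd : ∀ s, dualDensity L W s = 0) : W = 0 := by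
  obtain ⟨h, -, h0, -, h2⟩ := exists_pos_le_one_memLp_two m
  obtain ⟨s, hs⟩ := (μ.dense_of_ae hL).nonempty
  have hint : ⟪hc.evalOp s (h2.toLp h), W⟫_ℝ = 0 := by
    rw [← hs, ← inner_dualDensity, hd, inner_zero_right]
  have hinner : ∀ᵐ γ ∂η, ⟪hc.evalOp s (h2.toLp h) γ, W γ⟫_ℝ = h (γ s) * W γ := by
    filter_upwards [hc.coeFn_evalOp s (h2.toLp h), hc.ae_eval h2.coeFn_toLp s] with γ hγ hhγ
    rw [hγ, hhγ, RCLike.inner_apply, conj_trivial, mul_comm]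
  rw [L2.inner_def, integral_eq_zero_iff_of_nonneg_ae _ (L2.integrable_inner _ _)] at hint
  · refine Lp.eq_zero_iff_ae_eq_zero.2 ?_
    filter_upwards [hint, hinner] with γ hγ hhγ
    exact (mul_eq_zero.1 (hhγ.symm.trans hγ)).resolve_left (h0 _).ne'
  · filter_upwards [hinner, hW] with γ hγ hWγ
    rw [hγ]
    exact mul_nonneg (h0 _).le hWγ

variable [FirstCountableTopology S]

theorem ae_eq_comp (hL : IsEvalVersion μ hc L) {Φ : X × ℝ → ℝ} (hΦ : Continuous Φ)
    {g G : Lp ℝ 2 m} (hG : G =ᵐ[m] fun x => Φ (x, g x)) (s : S) :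
    L G s =ᵐ[η] fun γ => Φ (γ s, L g s γ) := by
  obtain ⟨r, hr, hrs⟩ := mem_closure_iff_seq_limit.1 (μ.dense_of_ae hL s)
  refine ae_mem_of_tendsto_Lp (R := {p : X × ℝ × ℝ | p.2.1 = Φ (p.1, p.2.2)})
    (fun γ => (γ.continuous.tendsto s).comp hrs) (((L G).continuous.tendsto s).comp hrs)
    (((L g).continuous.tendsto s).comp hrs)
    (isClosed_eq (by fun_prop) (by fun_prop)) fun n => ?_
  filter_upwards [hc.coeFn_evalOp (r n) G, hc.coeFn_evalOp (r n) g, hc.ae_eval hG (r n)]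
    with γ hGγ hgγ hγ
  simp only [Function.comp_apply]
  rw [hr n, hr n, hGγ, hgγ, hγ]

variable [PolishSpace X] {h : X → ℝ} (hm : Measurable h) (h0 : ∀ x, 0 < h x) (h2 : MemLp h 2 m)
  {s : S}

include hm h0

theorem mul_ae_eq_mul_eval (hL : IsEvalVersion μ hc L) (s : S) (g : Lp ℝ 2 m) :
    ∀ᵐ γ ∂η, h (γ s) * L g s γ = L (h2.toLp h) s γ * g (γ s) := by
  obtain ⟨G, hG, hGg⟩ := mem_closure_iff_seq_limit.1 (dense_continuous_mul hm h0 h2 g)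
  have hlim := ae_mem_of_tendsto_Lp (z := fun _ (γ : C(S, X)) => (h (γ s), L (h2.toLp h) s γ))
    (R := {p : (ℝ × ℝ) × ℝ × ℝ | p.1.1 * p.2.1 = p.1.2 * p.2.2}) (fun _ => tendsto_const_nhds)
    ((((continuous_eval_const s).comp L.continuous).tendsto g).comp hGg)
    (((hc.evalOp s).continuous.tendsto g).comp hGg)
    (isClosed_eq (by fun_prop) (by fun_prop)) fun n => by
      obtain ⟨φ, hφ, hφG⟩ := hG n
      have hφH : G n =ᵐ[m] fun x => φ x * h2.toLp h x := by
        filter_upwards [hφG, h2.coeFn_toLp] with x hx hhx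
        rw [hx, hhx]
      filter_upwards [hL.ae_eq_comp (Φ := fun p => φ p.1 * p.2) (by fun_prop) hφH s,
        hc.coeFn_evalOp s (G n), hc.ae_eval hφG s] with γ hγ hGγ hφγ
      simp only [Function.comp_apply]
      rw [hGγ, hφγ, hγ]
      ring
  filter_upwards [hlim, hc.coeFn_evalOp s g] with γ hγ hgγ
  rwa [← hgγ]

theorem mul_self_ae_eq (hL : IsEvalVersion μ hc L) (h1 : ∀ x, h x ≤ 1) (s : S) :
    ∀ᵐ γ ∂η, L (h2.toLp h) s γ * L (h2.toLp h) s γ = L (h2.toLp h) s γ * h (γ s) := by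
  have hh2 : MemLp (fun x => h x * h x) 2 m := by
    refine h2.mono (hm.mul hm).aestronglyMeasurable (ae_of_all _ fun x => ?_)
    rw [norm_mul, Real.norm_of_nonneg (h0 x).le]
    exact mul_le_of_le_one_left (h0 x).le (h1 x)
  have hsq : hh2.toLp _ =ᵐ[m] fun x => h2.toLp h x * h2.toLp h x := by
    filter_upwards [hh2.coeFn_toLp, h2.coeFn_toLp] with x hx hhx
    rw [hx, hhx]
  filter_upwards [hL.ae_eq_comp (Φ := fun p => p.2 * p.2) (by fun_prop) hsq s,
    hL.mul_ae_eq_mul_eval hm h0 h2 s (hh2.toLp _), hc.ae_eval hh2.coeFn_toLp s] with γ hγ hmul hhγ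
  rw [hγ, hhγ] at hmul
  refine mul_left_cancel₀ (h0 (γ s)).ne' ?_
  rw [hmul]
  ring

variable [SigmaFinite m] [IsProbabilityMeasure η]

theorem ae_toLp_ne_zero (hL : IsEvalVersion μ hc L) (hdet : MarginalsDetermined L s) :
    ∀ᵐ γ ∂η, L (h2.toLp h) s γ ≠ 0 := by
  have : Nonempty S := ⟨s⟩
  set N : Set C(S, X) := {γ | L (h2.toLp h) s γ = 0}
  have hN : MeasurableSet N := (Lp.stronglyMeasurable _).measurable (measurableSet_singleton 0)
  set W : Lp ℝ 2 η := indicatorConstLp 2 hN (measure_ne_top η N) 1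
  have hWN : W =ᵐ[η] N.indicator fun _ => (1 : ℝ) := indicatorConstLp_coeFn
  have hW : IsWeight W := hWN.mono fun γ hγ => by
    by_cases hγN : γ ∈ N <;> simp [hγ, hγN]
  have hds : dualDensity L W s = 0 := by
    refine ext_inner_left ℝ fun g => ?_
    rw [inner_dualDensity, inner_zero_right, L2.inner_def]
    refine integral_eq_zero_of_ae ?_
    filter_upwards [hL.mul_ae_eq_mul_eval hm h0 h2 s g, hWN] with γ hγ hWγ
    rw [hWγ]
    by_cases hγN : γ ∈ N
    · rw [show L (h2.toLp h) s γ = 0 from hγN, zero_mul] at hγ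
      simp [(mul_eq_zero.1 hγ).resolve_left (h0 _).ne']
    · simp [hγN]
  have hd0 (r : S) : dualDensity L 0 r = 0 := map_zero _
  have h0W : IsWeight (0 : Lp ℝ 2 η) := (Lp.coeFn_zero ℝ 2 η).mono fun _ hγ => by
    rw [hγ]
    exact ⟨le_rfl, zero_le_one⟩
  have hW0 : W = 0 := hL.eq_zero_of_dualDensity_eq_zero (hW.mono fun _ hγ => hγ.1) fun r =>
    (hdet W 0 hW h0W (hds.trans (hd0 s).symm) r).trans (hd0 r)
  filter_upwards [hWN, Lp.eq_zero_iff_ae_eq_zero.1 hW0] with γ hγ hγ0 hγN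
  rw [hγ, indicator_of_mem (show γ ∈ N from hγN)] at hγ0
  exact one_ne_zero hγ0

omit hm h0 in
theorem eq_evalOp (hL : IsEvalVersion μ hc L) (hdet : MarginalsDetermined L s) (g : Lp ℝ 2 m) :
    L g s = hc.evalOp s g := by
  obtain ⟨h, hm, h0, h1, h2⟩ := exists_pos_le_one_memLp_two m
  refine Lp.ext ?_
  filter_upwards [hL.ae_toLp_ne_zero hm h0 h2 hdet, hL.mul_self_ae_eq hm h0 h2 h1 s,
    hL.mul_ae_eq_mul_eval hm h0 h2 s g, hc.coeFn_evalOp s g] with γ hne hsq hmul hγ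
  rw [mul_left_cancel₀ hne hsq] at hmul
  rw [hγ, mul_left_cancel₀ (h0 _).ne' hmul]

end IsEvalVersion

end EveryTime

/-! ### The zero–one law -/

section Disintegration

variable {X Ω : Type*} [MeasurableSpace X] [MeasurableSpace Ω] {η : Measure Ω} {e : Ω → X}
  {κ : Kernel X Ω}

theorem compProd_eq_map_prodMk [MeasurableEq X] [IsFiniteMeasure η] [IsFiniteKernel κ]
    (he : Measurable e) (hη : η = (η.map e).bind κ)
    (hκ : ∀ᵐ x ∂(η.map e), ∀ᵐ ω ∂(κ x), e ω = x) :
    η.map e ⊗ₘ κ = η.map fun ω => (e ω, ω) := by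
  have hsnd : (η.map e ⊗ₘ κ).map Prod.snd = η := (Measure.snd_compProd _ _).trans hη.symm
  have hfst : ∀ᵐ p ∂(η.map e ⊗ₘ κ), p = (e p.2, p.2) := by
    have := Measure.ae_compProd_of_ae_ae
      (measurableSet_eq_fun (he.comp measurable_snd) measurable_fst) hκ
    exact this.mono fun p hp => Prod.ext (Eq.symm hp) rfl
  calc η.map e ⊗ₘ κ = (η.map e ⊗ₘ κ).map fun p => (e p.2, p.2) :=
        Measure.map_id.symm.trans (Measure.map_congr hfst)
    _ = ((η.map e ⊗ₘ κ).map Prod.snd).map fun ω => (e ω, ω) :=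
        (Measure.map_map (he.prodMk measurable_id) measurable_snd).symm
    _ = η.map fun ω => (e ω, ω) := by rw [hsnd]

variable [IsProbabilityMeasure η] [IsMarkovKernel κ]

theorem setIntegral_measureReal_kernel (he : Measurable e)
    (hκ : η.map e ⊗ₘ κ = η.map fun ω => (e ω, ω)) {B : Set X} (hB : MeasurableSet B) {S : Set Ω}
    (hS : MeasurableSet S) :
    ∫ ω in e ⁻¹' B, (κ (e ω)).real S ∂η = η.real (e ⁻¹' B ∩ S) := by
  have hlint : ∫⁻ ω in e ⁻¹' B, κ (e ω) S ∂η = η (e ⁻¹' B ∩ S) := by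
    rw [← setLIntegral_map hB (κ.measurable_coe hS) he, ← Measure.compProd_apply_prod hB hS, hκ]
    exact Measure.map_apply (he.prodMk measurable_id) (hB.prod hS)
  rw [measureReal_def, ← hlint]
  exact integral_toReal ((κ.measurable_coe hS).comp he).aemeasurable
    (ae_of_all _ fun ω => measure_lt_top _ _)

theorem ae_zero_or_one_of_setIntegral_eq (he : Measurable e)
    (hκ : η.map e ⊗ₘ κ = η.map fun ω => (e ω, ω)) {S : Set Ω} (hS : MeasurableSet S)
    (h : ∫ ω in S, (κ (e ω)).real S ∂η = η.real S) :
    ∀ᵐ x ∂(η.map e), κ x S = 0 ∨ κ x S = 1 := by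
  have hκS : Measurable fun x => (κ x).real S := (κ.measurable_coe hS).ennreal_toReal
  have hint : Integrable (fun ω => (κ (e ω)).real S) (η.restrict S) :=
    .of_bound (hκS.comp he).aestronglyMeasurable 1 (ae_of_all _ fun ω => by
      rw [Real.norm_of_nonneg measureReal_nonneg]; exact measureReal_le_one)
  have hone : ∀ᵐ ω ∂η, ω ∈ S → (κ (e ω)).real S = 1 := by
    rw [← ae_restrict_iff' hS]
    refine (integral_eq_iff_of_ae_le hint (integrable_const 1)
      (ae_of_all _ fun ω => measureReal_le_one)).1 ?_
    rw [h, setIntegral_one_eq_measureReal]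
  have hfib : ∀ᵐ x ∂(η.map e), ∀ᵐ ω ∂(κ x), ω ∈ S → (κ x).real S = 1 := by
    refine Measure.ae_ae_of_ae_compProd
      (p := fun p : X × Ω => p.2 ∈ S → (κ p.1).real S = 1) ?_
    rw [hκ]
    refine (ae_map_iff (he.prodMk measurable_id).aemeasurable ?_).2 hone
    exact (measurable_snd hS).imp
      (measurableSet_eq_fun (hκS.comp measurable_fst) measurable_const)
  filter_upwards [hfib] with x hx
  refine or_iff_not_imp_left.2 fun h0 => ?_
  obtain ⟨ω, hω, hω₁⟩ := ((frequently_ae_mem_iff.2 h0).and_eventually hx).exists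
  exact (ENNReal.toReal_eq_one_iff _).1 (hω₁ hω)

end Disintegration

section ZeroOne

variable {S X : Type*} [TopologicalSpace S] [TopologicalSpace X] [MeasurableSpace X]
  [BorelSpace X] [MeasurableSpace C(S, X)] [BorelSpace C(S, X)] {m : Measure X} [SigmaFinite m]
  {η : Measure C(S, X)} {c : ℝ≥0} {hc : BoundedCompression η m c}
  {L : Lp ℝ 2 m →L[ℝ] C(S, Lp ℝ 2 η)}

theorem dualDensity_eq_iff_of_eq_evalOp {s : S} (hs : ∀ g, L g s = hc.evalOp s g)
    {W₁ W₂ : Lp ℝ 2 η} :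
    dualDensity L W₁ s = dualDensity L W₂ s ↔ ∀ B, MeasurableSet B → m B < ∞ →
      ∫ γ in (fun γ => γ s) ⁻¹' B, W₁ γ ∂η = ∫ γ in (fun γ => γ s) ⁻¹' B, W₂ γ ∂η := by
  have hset {B : Set X} (hB : MeasurableSet B) (hmB : m B < ∞) (W : Lp ℝ 2 η) :
      ∫ x in B, dualDensity L W s x ∂m = ∫ γ in (fun γ => γ s) ⁻¹' B, W γ ∂η := by
    rw [← L2.inner_indicatorConstLp_one hB hmB.ne, inner_dualDensity, hs,
      hc.inner_evalOp_indicator s hB hmB.ne]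
  refine ⟨fun h B hB hmB => by rw [← hset hB hmB, h, hset hB hmB], fun h => Lp.ext ?_⟩
  refine ae_eq_of_forall_setIntegral_eq_of_sigmaFinite
    (fun B _ hB => integrableOn_of_memLp_two (Lp.memLp _) hB)
    (fun B _ hB => integrableOn_of_memLp_two (Lp.memLp _) hB) fun B hB hmB => ?_
  rw [hset hB hmB, hset hB hmB, h B hB hmB]

/-- The weights `γ ↦ 1_E (γ s)` and `γ ↦ P(γ s ∈ E | γ s₀)` have the same marginal at `s₀`, hence
at `s`: the conditional probability is `1` where `γ s ∈ E`. -/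
theorem MarginalsDetermined.ae_zero_or_one [IsProbabilityMeasure η] {s₀ : S}
    (hdet : MarginalsDetermined L s₀) (hs₀ : ∀ g, L g s₀ = hc.evalOp s₀ g) {κ : Kernel X C(S, X)}
    [IsMarkovKernel κ] (hκ : η.map (fun γ => γ s₀) ⊗ₘ κ = η.map fun γ => (γ s₀, γ))
    {s : S} (hs : ∀ g, L g s = hc.evalOp s g) {E : Set X} (hE : MeasurableSet E)
    (hmE : m E < ∞) :
    ∀ᵐ x ∂(η.map fun γ => γ s₀), κ x ((fun γ => γ s) ⁻¹' E) = 0 ∨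
      κ x ((fun γ => γ s) ⁻¹' E) = 1 := by
  set D : Set C(S, X) := (fun γ => γ s) ⁻¹' E
  have hD : MeasurableSet D := measurable_eval s hE
  have hcond : MemLp (fun γ : C(S, X) => (κ (γ s₀)).real D) 2 η :=
    .of_bound ((κ.measurable_coe hD).ennreal_toReal.comp
      (measurable_eval s₀)).aestronglyMeasurable 1 (ae_of_all _ fun γ => by
        rw [Real.norm_of_nonneg measureReal_nonneg]; exact measureReal_le_one)
  set W₁ : Lp ℝ 2 η := indicatorConstLp 2 hD (measure_ne_top η D) 1
  set W₂ : Lp ℝ 2 η := hcond.toLp _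
  have hW₁ : W₁ =ᵐ[η] D.indicator fun _ => (1 : ℝ) := indicatorConstLp_coeFn
  have hW₂ : W₂ =ᵐ[η] fun γ => (κ (γ s₀)).real D := hcond.coeFn_toLp
  have hweight₁ : IsWeight W₁ := by
    filter_upwards [hW₁] with γ hγ
    rw [hγ]
    by_cases h : γ ∈ D <;> simp [h]
  have hweight₂ : IsWeight W₂ := by
    filter_upwards [hW₂] with γ hγ
    rw [hγ]
    exact ⟨measureReal_nonneg, measureReal_le_one⟩
  have hint (B : Set C(S, X)) : ∫ γ in B, W₁ γ ∂η = η.real (B ∩ D) := by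
    rw [integral_congr_ae (ae_restrict_of_ae hW₁), setIntegral_indicator hD,
      setIntegral_one_eq_measureReal]
  have h₀ : dualDensity L W₁ s₀ = dualDensity L W₂ s₀ := by
    refine (dualDensity_eq_iff_of_eq_evalOp hs₀).2 fun B hB _ => ?_
    rw [hint, integral_congr_ae (ae_restrict_of_ae hW₂),
      setIntegral_measureReal_kernel (measurable_eval s₀) hκ hB hD]
  have hsE := (dualDensity_eq_iff_of_eq_evalOp hs).1 (hdet _ _ hweight₁ hweight₂ h₀ s) E hE hmE
  refine ae_zero_or_one_of_setIntegral_eq (measurable_eval s₀) hκ hD ?_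
  rw [← integral_congr_ae (ae_restrict_of_ae hW₂), ← hsE, hint, inter_self]

end ZeroOne

/-! ### Dirac masses and selections -/

section Dirac

variable {Ω : Type*} [MeasurableSpace Ω]

theorem eq_dirac_of_singleton_mem_ae {μ : Measure Ω} [IsProbabilityMeasure μ] {ω : Ω}
    (h : {ω} ∈ ae μ) : μ = Measure.dirac ω := by
  calc μ = μ.map fun _ => ω := Measure.map_id.symm.trans (Measure.map_congr h)
    _ = Measure.dirac ω := by rw [Measure.map_const, measure_univ, one_smul]

theorem ae_exists_eq_dirac_of_forall_separating {X : Type*} [MeasurableSpace X] {ν : Measure X}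
    {κ : Kernel X Ω} [IsMarkovKernel κ] {p : Set Ω → Prop}
    (hsep : HasCountableSeparatingOn Ω p univ) (hp : ∀ U, p U → MeasurableSet U)
    (h : ∀ U, p U → ∀ᵐ x ∂ν, κ x U = 0 ∨ κ x U = 1) :
    ∀ᵐ x ∂ν, ∃ ω, κ x = Measure.dirac ω := by
  obtain ⟨𝒰, h𝒰, h𝒰p, hsep⟩ := exists_countable_separating Ω p univ
  have : HasCountableSeparatingOn Ω (· ∈ 𝒰) univ := ⟨𝒰, h𝒰, fun _ hU => hU, hsep⟩
  filter_upwards [(ae_ball_iff h𝒰).2 fun U hU => h U (h𝒰p U hU)] with x hx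
  have : Nonempty Ω := nonempty_of_isProbabilityMeasure (κ x)
  obtain ⟨ω, hω⟩ := exists_singleton_mem_of_forall_separating (l := ae (κ x)) (· ∈ 𝒰)
    fun U hU => (hx U hU).symm.imp
      (mem_ae_iff_prob_eq_one (hp U (h𝒰p U hU))).2 compl_mem_ae_iff.2
  exact ⟨ω, eq_dirac_of_singleton_mem_ae hω⟩

theorem hasCountableSeparatingOn_measure_lt_top (m : Measure Ω) [SigmaFinite m]
    [MeasurableSpace.CountablySeparated Ω] :
    HasCountableSeparatingOn Ω (fun E => MeasurableSet E ∧ m E < ∞) univ := by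
  obtain ⟨𝒰, h𝒰, h𝒰m, hsep⟩ := exists_countable_separating Ω MeasurableSet univ
  refine ⟨image2 (fun E n => E ∩ spanningSets m n) 𝒰 univ, h𝒰.image2 countable_univ _, ?_, ?_⟩
  · rintro _ ⟨E, hE, n, -, rfl⟩
    exact ⟨(h𝒰m E hE).inter (measurableSet_spanningSets m n),
      (measure_mono inter_subset_right).trans_lt (measure_spanningSets_lt_top m n)⟩
  · intro x hx y hy hxy
    have hmem (E : Set Ω) (z : Ω) : z ∈ E ↔ ∃ n, z ∈ E ∩ spanningSets m n := by
      rw [← mem_iUnion, ← inter_iUnion, iUnion_spanningSets, inter_univ]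
    refine hsep x hx y hy fun E hE => ?_
    simp only [hmem E, fun n => hxy _ (mem_image2_of_mem hE (mem_univ n))]

theorem hasCountableSeparatingOn_eval {S X : Type*} [TopologicalSpace S]
    [SecondCountableTopology S] [TopologicalSpace X] [T2Space X] {p : Set X → Prop}
    (hp : HasCountableSeparatingOn X p univ) {D : Set S} (hD : Dense D) :
    HasCountableSeparatingOn C(S, X) (fun U => ∃ s ∈ D, ∃ E, p E ∧ (fun γ => γ s) ⁻¹' E = U)
      univ := by
  obtain ⟨Q, hQD, hQ, hQd⟩ := hD.exists_countable_dense_subset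
  obtain ⟨𝒰, h𝒰, h𝒰p, hsep⟩ := exists_countable_separating X p univ
  refine ⟨image2 (fun s E => (fun γ => γ s) ⁻¹' E) Q 𝒰, hQ.image2 h𝒰 _, ?_, ?_⟩
  · rintro _ ⟨s, hs, E, hE, rfl⟩
    exact ⟨s, hQD hs, E, h𝒰p E hE, rfl⟩
  · intro γ₁ _ γ₂ _ hγ
    refine DFunLike.coe_injective (γ₁.continuous.ext_on hQd γ₂.continuous fun s hs => ?_)
    exact hsep _ (mem_univ _) _ (mem_univ _) fun E hE => hγ _ (mem_image2_of_mem hs hE)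

theorem exists_measurable_section_of_ae_eq_dirac [StandardBorelSpace Ω] {X : Type*}
    [MeasurableSpace X] {ν : Measure X} {κ : Kernel X Ω} [IsMarkovKernel κ] {e : Ω → X}
    {σ : X → Ω} (hσ : Measurable σ) (hσe : ∀ x, e (σ x) = x)
    (hκ : ∀ᵐ x ∂ν, ∀ᵐ ω ∂(κ x), e ω = x) (hdirac : ∀ᵐ x ∂ν, ∃ ω, κ x = Measure.dirac ω) :
    ∃ f, Measurable f ∧ (∀ x, e (f x) = x) ∧ ∀ᵐ x ∂ν, κ x = Measure.dirac (f x) := by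
  classical
  obtain ⟨N, hN, hNm, hNκ⟩ := (hκ.and hdirac).exists_measurable_mem
  set κ' : Kernel X Ω := .piecewise hNm κ (.deterministic σ hσ) with hκ'
  have hgood (x : X) : (∀ᵐ ω ∂(κ' x), e ω = x) ∧ ∃ ω, κ' x = Measure.dirac ω := by
    by_cases hx : x ∈ N
    · simpa only [hκ', Kernel.piecewise_apply, if_pos hx] using hNκ x hx
    · simp only [hκ', Kernel.piecewise_apply, if_neg hx, Kernel.deterministic_apply, ae_dirac_eq]
      exact ⟨hσe x, σ x, rfl⟩
  have : IsDeterministic κ' := (Kernel.isDeterministic_iff_isZeroOneMeasure κ').2 fun x => by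
    obtain ⟨ω, hω⟩ := (hgood x).2
    rw [hω, ← Kernel.deterministic_apply (measurable_const (a := ω)) x]
    exact (Kernel.isDeterministic_iff_isZeroOneMeasure _).1 inferInstance x
  obtain ⟨f, hf, hκf⟩ := Kernel.IsDeterministic.exists_eq_deterministic κ'
  refine ⟨f, hf, fun x => ?_, ?_⟩
  · have hx := (hgood x).1
    rw [hκf, Kernel.deterministic_apply, ae_dirac_eq] at hx
    exact hx
  · filter_upwards [hN] with x hx
    rw [← Kernel.deterministic_apply hf, ← hκf, hκ', Kernel.piecewise_apply, if_pos hx]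

end Dirac

/-! ### Paths in a field with unique weak solutions -/

section Paths

variable {X : Type*} [TopologicalSpace X] [PolishSpace X] [MeasurableSpace X] [BorelSpace X]
  {T : ℝ} {hT : 0 < T} [MeasurableSpace C(Icc (0 : ℝ) T, X)] [BorelSpace C(Icc (0 : ℝ) T, X)]
  {η : Measure C(Icc (0 : ℝ) T, X)}

variable (hT η) in
theorem exists_isDisintegration [IsProbabilityMeasure η] : ∃ κ, IsDisintegration hT η κ := by
  have : Nonempty C(Icc (0 : ℝ) T, X) := nonempty_of_isProbabilityMeasure η
  have he : Measurable (evalAt (X := X) (time0 hT)) := measurable_eval _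
  refine ⟨condDistrib id (evalAt (time0 hT)) η, fun x => inferInstance, ?_, ?_⟩
  · rw [condDistrib_comp_map he.aemeasurable aemeasurable_id, Measure.map_id]
  · refine Measure.ae_ae_of_ae_compProd (p := fun p : X × C(Icc (0 : ℝ) T, X) =>
      evalAt (time0 hT) p.2 = p.1) ?_
    rw [compProd_map_condDistrib aemeasurable_id]
    exact (ae_map_iff (he.prodMk measurable_id).aemeasurable
      (measurableSet_eq_fun (he.comp measurable_snd) measurable_fst)).2 (ae_of_all _ fun _ => rfl)

namespace IsDisintegration

variable {κ : Kernel X C(Icc (0 : ℝ) T, X)}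

theorem exists_measurable_selection (hκ : IsDisintegration hT η κ)
    (hdirac : ∀ᵐ x ∂(η.map (evalAt (time0 hT))), ∃ γ, κ x = Measure.dirac γ) :
    ∃ S : X → C(Icc (0 : ℝ) T, X), Measurable S ∧ (∀ x, evalAt (time0 hT) (S x) = x) ∧
      η = (η.map (evalAt (time0 hT))).bind fun x => Measure.dirac (S x) := by
  have : IsMarkovKernel κ := ⟨hκ.1⟩
  obtain ⟨S, hS, hS₀, hκS⟩ := exists_measurable_section_of_ae_eq_dirac
    (σ := ContinuousMap.const _) ContinuousMap.continuous_const'.measurable (fun _ => rfl)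
    hκ.2.2 hdirac
  exact ⟨S, hS, hS₀, hκ.2.1.trans (Measure.bind_congr_right hκS)⟩

theorem ae_exists_eq_dirac [IsProbabilityMeasure η] {m : Measure X} [SigmaFinite m]
    {A : Submodule ℝ (Lp ℝ 2 m)} {V : WeakField A} {c : ℝ≥0}
    (hκ : IsDisintegration hT η κ) (hA : Dense (A : Set (Lp ℝ 2 m)))
    (hAb : ∀ f ∈ A, MemLp f ∞ m) (hV : ∀ f, DominatedInL1L1Linf m T (V.dfn f))
    (hunique : V.UniqueInLPlus T) (hη : V.ConcentratedOnSolutions hT η)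
    (hc : BoundedCompression η m c) :
    ∀ᵐ x ∂(η.map (evalAt (time0 hT))), ∃ γ, κ x = Measure.dirac γ := by
  have : IsMarkovKernel κ := ⟨hκ.1⟩
  have := isOpenPosMeasure_Icc hT
  obtain ⟨L, hL⟩ := V.exists_isEvalVersion hA hAb hη hc
  have hdet := hL.marginalsDetermined hAb hV hη hunique
  have hκη := compProd_eq_map_prodMk (measurable_eval (time0 hT)) hκ.2.1 hκ.2.2
  have hsep := hasCountableSeparatingOn_eval (hasCountableSeparatingOn_measure_lt_top m)
    (Measure.dense_of_ae hL)
  refine ae_exists_eq_dirac_of_forall_separating hsep ?_ ?_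
  · rintro _ ⟨s, -, E, ⟨hE, -⟩, rfl⟩
    exact measurable_eval s hE
  · rintro _ ⟨s, hs, E, ⟨hE, hmE⟩, rfl⟩
    exact hdet.ae_zero_or_one (hL.eq_evalOp hdet) hκη hs hE hmE

end IsDisintegration

end Paths

/-! ### Families of derivations -/

section Families

variable {X : Type*} [MeasurableSpace X] {m : Measure X} {𝓔 : DirichletForm m}
  {C : CarreDuChamp 𝓔} {A : Submodule ℝ (Lp ℝ 2 m)} {T : ℝ} {b : ℝ → Deriv C A}

theorem IsTestAlgebra.dense_coe (hA : IsTestAlgebra C A) : Dense (A : Set (Lp ℝ 2 m)) := by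
  refine .of_closure (𝓔.dense.mono fun f hf => Metric.mem_closure_iff.2 fun ε hε => ?_)
  obtain ⟨g, hg, hgε⟩ := hA.dense f hf (.ofReal (ε ^ 2)) (ENNReal.ofReal_pos.2 (by positivity))
  have hnorm : ENNReal.ofReal (‖g - f‖ ^ 2) < ENNReal.ofReal (ε ^ 2) := le_self_add.trans_lt hgε
  refine ⟨g, hg, ?_⟩
  rw [dist_comm, dist_eq_norm]
  exact lt_of_pow_lt_pow_left₀ 2 hε.le ((ENNReal.ofReal_lt_ofReal_iff (by positivity)).1 hnorm)

theorem MemL1L1Linf.const_mul {g : ℝ × X → ℝ} (hg : MemL1L1Linf T m g) (K : ℝ) :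
    MemL1L1Linf T m fun z => K * g z := by
  obtain ⟨g₁, g₂, hm₁, hm₂, hsum, h₁, h₂⟩ := hg
  have hK (p : ℝ≥0∞) {w : ℝ × X → ℝ} (hw : ∫⁻ t in Ioo 0 T, eLpNorm (fun x => w (t, x)) p m < ∞) :
      ∫⁻ t in Ioo 0 T, eLpNorm (fun x => K * w (t, x)) p m < ∞ :=
    calc ∫⁻ t in Ioo 0 T, eLpNorm (fun x => K * w (t, x)) p m
        ≤ ∫⁻ t in Ioo 0 T, ‖K‖ₑ * eLpNorm (fun x => w (t, x)) p m :=
          lintegral_mono fun t => eLpNorm_const_smul_le (c := K)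
      _ = ‖K‖ₑ * ∫⁻ t in Ioo 0 T, eLpNorm (fun x => w (t, x)) p m :=
          lintegral_const_mul' _ _ enorm_ne_top
      _ < ∞ := ENNReal.mul_lt_top enorm_lt_top hw
  refine ⟨fun z => K * g₁ z, fun z => K * g₂ z, hm₁.const_mul K, hm₂.const_mul K, ?_,
    hK 1 h₁, hK ∞ h₂⟩
  filter_upwards [hsum] with t ht
  filter_upwards [ht] with x hx
  rw [hx, mul_add]

namespace BorelRep

/-- The field given by a choice of Borel representatives for a family of derivations. -/
def toWeakField (R : BorelRep T b) : WeakField A where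
  __ := R

theorem dominatedInL1L1Linf (R : BorelRep T b) (hA : IsTestAlgebra C A)
    (hb : FamilyInL1L1Linf T b) (f : A) : DominatedInL1L1Linf m T (R.dfn f) := by
  obtain ⟨g, ⟨⟨-, hg0, hgb⟩, -⟩, hg⟩ := hb
  have hΓ := ae_abs_le_eLpNorm_top (hA.gamma_bdd f f.2)
  refine ⟨_, hg.const_mul √(eLpNorm (C.Γ (f : Lp ℝ 2 m)) ∞ m).toReal, ?_⟩
  filter_upwards [hgb, R.dfn_ae f] with t ht hdf
  filter_upwards [ht f, hdf, hΓ] with x hx hdx hΓx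
  calc |R.dfn f (t, x)| = |(b t).d f x| := by rw [hdx]
    _ ≤ g (t, x) * √(C.Γ (f : Lp ℝ 2 m) x) := hx
    _ ≤ g (t, x) * √(eLpNorm (C.Γ (f : Lp ℝ 2 m)) ∞ m).toReal := by
        gcongr
        exacts [hg0 _, (le_abs_self _).trans hΓx]
    _ = _ := mul_comm _ _

theorem solvesContinuityEq_toWeakField (R : BorelRep T b) {u : ℝ → X → ℝ} {u₀ : X → ℝ} :
    R.toWeakField.SolvesContinuityEq T u u₀ ↔ SolvesContinuityEq T b u u₀ := by
  refine forall₂_congr fun f ψ => imp_congr_right fun _ => imp_congr_right fun _ => ?_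
  refine Eq.congr ?_ ?_
  · refine integral_congr_ae ((R.dfn_ae f).mono fun t ht => integral_congr_ae ?_)
    filter_upwards [R.fn_ae f, ht] with x hfx hdx
    simp only [toWeakField, hfx, hdx]
  · congr 1
    exact integral_congr_ae ((R.fn_ae f).mono fun x hx => by simp only [toWeakField, hx])

theorem uniqueInLPlus_toWeakField (R : BorelRep T b) (h : UniqueInLPlus T b) :
    R.toWeakField.UniqueInLPlus T := fun u₀ h₁ h_top u v hu hv hsu hsv =>
  h u₀ h₁ h_top u v hu hv (R.solvesContinuityEq_toWeakField.1 hsu)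
    (R.solvesContinuityEq_toWeakField.1 hsv)

end BorelRep

end Families

end NoSplitting

end

theorem theorem8p4_general {X : Type*} [TopologicalSpace X] [PolishSpace X] [MeasurableSpace X]
    [BorelSpace X] {m : Measure X} [SigmaFinite m] {A : Submodule ℝ (Lp ℝ 2 m)}
    (hA : Dense (A : Set (Lp ℝ 2 m))) (hAb : ∀ f ∈ A, MemLp f ∞ m) {T : ℝ} (hT : 0 < T)
    (V : NoSplitting.WeakField A) (hV : ∀ f, NoSplitting.DominatedInL1L1Linf m T (V.dfn f))
    (hunique : V.UniqueInLPlus T)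
    [MeasurableSpace C(Icc (0 : ℝ) T, X)] [BorelSpace C(Icc (0 : ℝ) T, X)]
    (η : Measure C(Icc (0 : ℝ) T, X)) [IsProbabilityMeasure η]
    (hη : V.ConcentratedOnSolutions hT η)
    (hbound : ∃ L₀, NoSplitting.BoundedCompression η m L₀) :
    (∀ κ : Kernel X C(Icc (0 : ℝ) T, X), NoSplitting.IsDisintegration hT η κ →
      ∀ᵐ x ∂(η.map (NoSplitting.evalAt (NoSplitting.time0 hT))), ∃ γ, κ x = Measure.dirac γ) ∧
    (∃ S : X → C(Icc (0 : ℝ) T, X), Measurable S ∧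
      (∀ x, NoSplitting.evalAt (NoSplitting.time0 hT) (S x) = x) ∧
      (∀ f : A, ∀ᵐ x ∂(η.map (NoSplitting.evalAt (NoSplitting.time0 hT))),
        NoSplitting.HasVelocityAlong hT (V.fn f) (V.dfn f) (S x)) ∧
      η = (η.map (NoSplitting.evalAt (NoSplitting.time0 hT))).bind
        (fun x => Measure.dirac (S x))) := by
  obtain ⟨L₀, hc⟩ := hbound
  have hdirac (κ : Kernel X C(Icc (0 : ℝ) T, X)) (hκ : NoSplitting.IsDisintegration hT η κ) :=
    hκ.ae_exists_eq_dirac hA hAb hV hunique hη hc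
  obtain ⟨κ, hκ⟩ := NoSplitting.exists_isDisintegration hT η
  obtain ⟨S, hS, hS₀, hηS⟩ := hκ.exists_measurable_selection (hdirac κ hκ)
  refine ⟨hdirac, S, hS, hS₀, fun f => ?_, hηS⟩
  have hf := hη f
  rw [hηS] at hf
  filter_upwards [Measure.ae_ae_of_ae_bind (Measure.measurable_dirac.comp hS).aemeasurable hf]
    with x hx
  rwa [Function.comp_apply, ae_dirac_eq] at hx

theorem theorem8p4 {X : Type*} [TopologicalSpace X] [PolishSpace X] [MeasurableSpace X]
    [BorelSpace X] (m : Measure X) [SigmaFinite m] [m.IsOpenPosMeasure]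
    (𝓔 : NoSplitting.DirichletForm m) (C : NoSplitting.CarreDuChamp 𝓔)
    (A : Submodule ℝ (Lp ℝ 2 m)) (hA : NoSplitting.IsTestAlgebra C A)
    (T : ℝ) (hT : 0 < T)
    (b : ℝ → NoSplitting.Deriv C A) (hb : NoSplitting.FamilyInL1L1Linf T b)
    (hunique : NoSplitting.UniqueInLPlus T b)
    (R : NoSplitting.BorelRep T b)
    [MeasurableSpace C(Icc (0 : ℝ) T, X)] [BorelSpace C(Icc (0 : ℝ) T, X)]
    (η : Measure C(Icc (0 : ℝ) T, X)) [IsProbabilityMeasure η]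
    (hη : NoSplitting.ConcentratedOnSolutions hT R η)
    (hbound : ∃ L₀ : ℝ≥0, ∀ t : Icc (0 : ℝ) T,
      η.map (NoSplitting.evalAt t) ≤ (L₀ : ℝ≥0∞) • m) :
    (∀ κ : Kernel X C(Icc (0 : ℝ) T, X), NoSplitting.IsDisintegration hT η κ →
      ∀ᵐ x ∂(η.map (NoSplitting.evalAt (NoSplitting.time0 hT))),
        ∃ γ : C(Icc (0 : ℝ) T, X), κ x = Measure.dirac γ) ∧
    (∃ S : X → C(Icc (0 : ℝ) T, X), Measurable S ∧
      (∀ x, NoSplitting.evalAt (NoSplitting.time0 hT) (S x) = x) ∧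
      (∀ f : A, ∀ᵐ x ∂(η.map (NoSplitting.evalAt (NoSplitting.time0 hT))),
        NoSplitting.SolvesODE hT R f (S x)) ∧
      η = (η.map (NoSplitting.evalAt (NoSplitting.time0 hT))).bind
        (fun x => Measure.dirac (S x))) :=
  theorem8p4_general hA.dense_coe (fun f hf => hA.memLp f hf ∞ le_top) hT R.toWeakField
    (R.dominatedInL1L1Linf hA hb) (R.uniqueInLPlus_toWeakField hunique) η hη hbound
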